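/- **Theorem.** Let $I=\{(v_i,w_i)\}_{i=1}^n$, $n\ge 1$, be objects with real values $v_i\ge 0$ and real weights $w_i>0$, and let $m=|\{w_1,\dots,w_n\}|$ be the number of distinct weights. Let $$h_I(x)=\min\Big\{\sum_{i=1}^n w_i\xi_i \;:\; \xi\in\{0,1\}^n,\ \sum_{i=1}^n v_i\xi_i\ge x\Big\}\qquad(x\in\mathbb R)$$ be the smallest weight budget that allows total value at least $x$ ($+\infty$ if no selection does), and let $h_I^{-1}(y)=\max\{x : h_I(x)\le y\}$ ($-\infty$ if there is no such $x$), which for $y\ge 0$ is the optimal value of the $0/1$ knapsack problem with budget $y$. There are absolute constants $C,c>0$ and one algorithm (a fixed program for a unit-cost random access machine with exact real arithmetic $+,-,\times,\div,\le$ and without rounding) such that for all such inputs $(v_i,w_i)_{i=1}^n$ and every accuracy parameter $0<\varepsilon\le 1$, the algorithm halts within $$C\left(n+\frac{m^3}{\varepsilon^2}\right)\log\frac{\max(n,2)\,\max_i w_i}{\min_i w_i}$$ steps and outputs the list of breakpoints, in increasing order, of a nondecreasing step function $\tilde h_I^{-1}$ (with the value $-\infty$ to the left of its first breakpoint) that satisfies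 $$h_I^{-1}\!\left(\frac{y}{1+c\,\varepsilon}\right)\le \tilde h_I^{-1}(y)\le h_I^{-1}(y)\qquad\text{for all } y\in\mathbb R .$$ -/

import Mathlib

/-! ## The model of computation: a unit-cost RAM over the real numbers

A machine has a store with index (natural number) variables and arrays, real variables and arrays,
and a write-only output list. A program is a finite expression; it can add, subtract and compare
indices, add, subtract, multiply, divide and compare reals, read and write arrays at computed
indices, and use an index as a real number. There is no rounding, i.e. no way to turn a real number
into an index except through comparisons. Every operation costs one unit of time. -/

namespace RealRAM

/-- The store of the machine. Variables and arrays are named by natural numbers; a program mentions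
only finitely many names. -/
structure Store where
  /-- index variables -/
  ivar : ℕ → ℕ
  /-- index arrays: array name, then position -/
  iarr : ℕ → ℕ → ℕ
  /-- real variables -/
  rvar : ℕ → ℝ
  /-- real arrays: array name, then position -/
  rarr : ℕ → ℕ → ℝ
  /-- what has been written to the output so far, oldest entry first -/
  out : List (ℝ × ℝ)

/-- Index expressions. -/
inductive IExp where
  | const (k : ℕ)
  | var (x : ℕ)
  | get (a : ℕ) (i : IExp)
  | add (e₁ e₂ : IExp)
  | sub (e₁ e₂ : IExp)

/-- Real expressions. -/
inductive RExp where
  | ofIndex (e : IExp)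
  | var (x : ℕ)
  | get (a : ℕ) (i : IExp)
  | add (e₁ e₂ : RExp)
  | sub (e₁ e₂ : RExp)
  | mul (e₁ e₂ : RExp)
  | div (e₁ e₂ : RExp)

/-- Tests. -/
inductive BExp where
  | ile (e₁ e₂ : IExp)
  | rle (e₁ e₂ : RExp)
  | neg (b : BExp)
  | conj (b₁ b₂ : BExp)

/-- Programs. -/
inductive Prog where
  | skip
  | setIndex (x : ℕ) (e : IExp)
  | putIndex (a : ℕ) (i e : IExp)
  | setReal (x : ℕ) (e : RExp)
  | putReal (a : ℕ) (i : IExp) (e : RExp)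
  | emit (e₁ e₂ : RExp)
  | seq (p q : Prog)
  | branch (b : BExp) (p q : Prog)
  | loop (b : BExp) (p : Prog)

/-- Value of an index expression (subtraction is truncated at `0`). -/
def IExp.eval (σ : Store) : IExp → ℕ
  | .const k => k
  | .var x => σ.ivar x
  | .get a i => σ.iarr a (i.eval σ)
  | .add e₁ e₂ => e₁.eval σ + e₂.eval σ
  | .sub e₁ e₂ => e₁.eval σ - e₂.eval σ

/-- Time to evaluate an index expression: the number of its nodes. -/
def IExp.cost : IExp → ℕ
  | .const _ => 1
  | .var _ => 1
  | .get _ i => i.cost + 1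
  | .add e₁ e₂ => e₁.cost + e₂.cost + 1
  | .sub e₁ e₂ => e₁.cost + e₂.cost + 1

/-- Value of a real expression, in exact arithmetic. -/
noncomputable def RExp.eval (σ : Store) : RExp → ℝ
  | .ofIndex e => (e.eval σ : ℝ)
  | .var x => σ.rvar x
  | .get a i => σ.rarr a (i.eval σ)
  | .add e₁ e₂ => e₁.eval σ + e₂.eval σ
  | .sub e₁ e₂ => e₁.eval σ - e₂.eval σ
  | .mul e₁ e₂ => e₁.eval σ * e₂.eval σ
  | .div e₁ e₂ => e₁.eval σ / e₂.eval σ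

/-- Time to evaluate a real expression: the number of its nodes. -/
def RExp.cost : RExp → ℕ
  | .ofIndex e => e.cost + 1
  | .var _ => 1
  | .get _ i => i.cost + 1
  | .add e₁ e₂ => e₁.cost + e₂.cost + 1
  | .sub e₁ e₂ => e₁.cost + e₂.cost + 1
  | .mul e₁ e₂ => e₁.cost + e₂.cost + 1
  | .div e₁ e₂ => e₁.cost + e₂.cost + 1

/-- The test `b` succeeds in the store `σ`. -/
def BExp.Holds (σ : Store) : BExp → Prop
  | .ile e₁ e₂ => e₁.eval σ ≤ e₂.eval σ
  | .rle e₁ e₂ => e₁.eval σ ≤ e₂.eval σ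
  | .neg b => ¬ b.Holds σ
  | .conj b₁ b₂ => b₁.Holds σ ∧ b₂.Holds σ

/-- Time to evaluate a test: the number of its nodes. -/
def BExp.cost : BExp → ℕ
  | .ile e₁ e₂ => e₁.cost + e₂.cost + 1
  | .rle e₁ e₂ => e₁.cost + e₂.cost + 1
  | .neg b => b.cost + 1
  | .conj b₁ b₂ => b₁.cost + b₂.cost + 1

/-- Overwrite one entry of a two-dimensional table. -/
def put {α : Type} (f : ℕ → ℕ → α) (a i : ℕ) (z : α) : ℕ → ℕ → α :=
  Function.update f a (Function.update (f a) i z)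

/-- `Exec p σ t σ'`: the program `p`, started in the store `σ`, halts after exactly `t` units of time
in the store `σ'`. -/
inductive Exec : Prog → Store → ℕ → Store → Prop
  | skip (σ : Store) : Exec .skip σ 1 σ
  | setIndex (σ : Store) (x : ℕ) (e : IExp) :
      Exec (.setIndex x e) σ (e.cost + 1)
        { σ with ivar := Function.update σ.ivar x (e.eval σ) }
  | putIndex (σ : Store) (a : ℕ) (i e : IExp) :
      Exec (.putIndex a i e) σ (i.cost + e.cost + 1)
        { σ with iarr := put σ.iarr a (i.eval σ) (e.eval σ) }
  | setReal (σ : Store) (x : ℕ) (e : RExp) :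
      Exec (.setReal x e) σ (e.cost + 1)
        { σ with rvar := Function.update σ.rvar x (e.eval σ) }
  | putReal (σ : Store) (a : ℕ) (i : IExp) (e : RExp) :
      Exec (.putReal a i e) σ (i.cost + e.cost + 1)
        { σ with rarr := put σ.rarr a (i.eval σ) (e.eval σ) }
  | emit (σ : Store) (e₁ e₂ : RExp) :
      Exec (.emit e₁ e₂) σ (e₁.cost + e₂.cost + 1)
        { σ with out := σ.out ++ [(e₁.eval σ, e₂.eval σ)] }
  | seq {p q : Prog} {σ σ' σ'' : Store} {t t' : ℕ} (hp : Exec p σ t σ') (hq : Exec q σ' t' σ'') :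
      Exec (.seq p q) σ (t + t') σ''
  | branch_true {b : BExp} {p q : Prog} {σ σ' : Store} {t : ℕ} (hb : b.Holds σ)
      (hp : Exec p σ t σ') : Exec (.branch b p q) σ (b.cost + t + 1) σ'
  | branch_false {b : BExp} {p q : Prog} {σ σ' : Store} {t : ℕ} (hb : ¬ b.Holds σ)
      (hq : Exec q σ t σ') : Exec (.branch b p q) σ (b.cost + t + 1) σ'
  | loop_false {b : BExp} {p : Prog} {σ : Store} (hb : ¬ b.Holds σ) :
      Exec (.loop b p) σ (b.cost + 1) σ
  | loop_true {b : BExp} {p : Prog} {σ σ' σ'' : Store} {t t' : ℕ} (hb : b.Holds σ)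
      (hp : Exec p σ t σ') (hl : Exec (.loop b p) σ' t' σ'') :
      Exec (.loop b p) σ (b.cost + t + t' + 1) σ''

end RealRAM

/-! ## The knapsack problem -/

namespace Knapsack

/-- The inverted knapsack function `h` of `n` objects with values `v` and weights `w`: the smallest
total weight of a selection of objects whose total value is at least `x` (`⊤` if there is none). -/
noncomputable def invKnapsack {n : ℕ} (v w : Fin n → ℝ) (x : ℝ) : EReal :=
  ⨅ (ξ : Finset (Fin n)) (_ : x ≤ ∑ i ∈ ξ, v i), ((∑ i ∈ ξ, w i : ℝ) : EReal)

/-- The inverse of a step function: the largest `x` with `f x ≤ y` (`⊥` if there is none). -/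
noncomputable def stepInverse (f : ℝ → EReal) (y : ℝ) : EReal :=
  ⨆ (x : ℝ) (_ : f x ≤ (y : EReal)), (x : EReal)

/-- A list of breakpoints describes a nondecreasing step function: positions increase strictly, and
the values there do not decrease. -/
def IsStepList (l : List (ℝ × ℝ)) : Prop :=
  l.Pairwise (fun p q => p.1 < q.1 ∧ p.2 ≤ q.2)

/-- The step function with breakpoints `(position, value)` in `l`: its value at `y` is the value of
the last breakpoint that is not to the right of `y` (`⊥` to the left of all breakpoints). As values
do not decrease along the list, this is the largest value of a breakpoint at or before `y`. -/
noncomputable def stepFun (l : List (ℝ × ℝ)) (y : ℝ) : EReal :=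
  ⨆ (p : ℝ × ℝ) (_ : p ∈ l ∧ p.1 ≤ y), (p.2 : EReal)

/-- The initial store for the input `n`, `v`, `w`, `ε`: index variable `0` holds `n`, real variable
`0` holds `ε`, real arrays `0` and `1` hold the values and the weights; all else is `0`. -/
noncomputable def input {n : ℕ} (v w : Fin n → ℝ) (ε : ℝ) : RealRAM.Store where
  ivar := fun x => if x = 0 then n else 0
  iarr := fun _ _ => 0
  rvar := fun x => if x = 0 then ε else 0
  rarr := fun a i =>
    if h : i < n then (if a = 0 then v ⟨i, h⟩ else if a = 1 then w ⟨i, h⟩ else 0) else 0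
  out := []

end Knapsack

/-!
The items of one weight `w` form a class for which the knapsack problem is trivial: the best
selection within a budget consists of the `⌊budget / w⌋` most valuable items. The algorithm sorts the
items by weight and, within a class, by decreasing value (`RealRAM.wp_sortItems`), and then adds the
`m` classes one after the other to a table `F` of achievable values, by `(max, +)`-convolution with
the table `G` of the class.

All tables live on one geometric grid of budgets `0, w₀, w₀ q, w₀ q², …` with `w₀` the least weight
and `q = 1 + ε / m`, extended to beyond the total weight; it has `O((m / ε) Λ)` points, where `Λ` is
the logarithm in the time bound. Rounding budgets up to the grid costs a factor `q` in each
convolution (`Knapsack.Approx.conv`), so the final accuracy is `q ^ (m + 1) ≤ 1 + 5 ε`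
(`Knapsack.pow_le_accuracy`).

A convolution is cheap because, of two budgets that fit into a grid point `k`, the larger one may be
assumed to be at least half of it, so it lies at most `L = O(m / ε)` steps below `k`; and if it lies
`d` steps below `k`, the best choice of the other lies `shift q K d` steps below `k`, a number that
by scale invariance depends on `d` only and is tabulated once (`Knapsack.exists_shift`). So one
convolution takes `O((m / ε)² Λ)` steps, all together `O((m³ / ε²) Λ)` (`Knapsack.mul_mul_le`). Merge
sort takes `O(n Λ)` steps since `log n ≤ Λ`, and the tables `G` take `O(n)` steps beyond their sizes,
as the number of items taken only grows with the budget (`RealRAM.wp_fillTable`).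

Programs are verified by symbolic execution (`RealRAM.wp`) with two rules for loops: `wp_for`, if the
memory after every iteration is known explicitly, and `wp_while`, with an invariant and a potential
function that pays for the running time.
-/

namespace RealRAM

/-! ### Symbolic execution of programs -/

/-- The part of the store that the knapsack program uses, with a name for every variable.
The program is verified over `Mem`; `Mem.store` embeds it into the machine. -/
structure Mem where
  /-- number of items -/
  n : ℕ
  i : ℕ
  j : ℕ
  k : ℕ
  /-- start of the blocks to be merged -/
  lo : ℕ
  mid : ℕ
  hi : ℕ
  /-- width of the sorted blocks in merge sort -/
  wid : ℕ
  /-- number of distinct weights -/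
  m : ℕ
  /-- index of the last grid point -/
  K : ℕ
  /-- number of grid steps within which the budget doubles -/
  L : ℕ
  /-- number of items processed, in sorted order -/
  p : ℕ
  d : ℕ
  /-- permutation that sorts the items -/
  A : ℕ → ℕ
  /-- second array for merge sort -/
  B : ℕ → ℕ
  /-- table of `Knapsack.shift` -/
  st : ℕ → ℕ
  /-- accuracy parameter -/
  eps : ℝ
  /-- ratio of the grid -/
  q : ℝ
  /-- weight of the current class -/
  wj : ℝ
  /-- total value of the items taken from the current class -/
  acc : ℝ
  /-- total weight of the items taken from the current class -/
  accw : ℝ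
  best : ℝ
  /-- values of the items -/
  V : ℕ → ℝ
  /-- weights of the items -/
  W : ℕ → ℝ
  /-- powers of `q` -/
  pw : ℕ → ℝ
  /-- grid of budgets -/
  Y : ℕ → ℝ
  /-- values achieved by the classes processed so far -/
  F : ℕ → ℝ
  /-- values achieved by the current class -/
  G : ℕ → ℝ
  /-- convolution of `F` and `G` -/
  H : ℕ → ℝ
  out : List (ℝ × ℝ)

namespace Mem

/-- The index variables; this fixes which variable each
number stands for in the programs below. -/
def getI (s : Mem) : ℕ → ℕ
  | 0 => s.n
  | 1 => s.i
  | 2 => s.j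
  | 3 => s.k
  | 4 => s.lo
  | 5 => s.mid
  | 6 => s.hi
  | 7 => s.wid
  | 8 => s.m
  | 9 => s.K
  | 10 => s.L
  | 11 => s.p
  | 12 => s.d
  | _ => 0

/-- The index arrays. -/
def getIA (s : Mem) : ℕ → ℕ → ℕ
  | 0 => s.A
  | 1 => s.B
  | 2 => s.st
  | _ => fun _ => 0

/-- The real variables. -/
def getR (s : Mem) : ℕ → ℝ
  | 0 => s.eps
  | 1 => s.q
  | 2 => s.wj
  | 3 => s.acc
  | 4 => s.accw
  | 5 => s.best
  | _ => 0

/-- The real arrays. -/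
def getRA (s : Mem) : ℕ → ℕ → ℝ
  | 0 => s.V
  | 1 => s.W
  | 2 => s.pw
  | 3 => s.Y
  | 4 => s.F
  | 5 => s.G
  | 6 => s.H
  | _ => fun _ => 0

/-- Assignment to an index variable, without effect for a number that names none. -/
def setI (s : Mem) (x z : ℕ) : Mem :=
  match x with
  | 0 => { s with n := z }
  | 1 => { s with i := z }
  | 2 => { s with j := z }
  | 3 => { s with k := z }
  | 4 => { s with lo := z }
  | 5 => { s with mid := z }
  | 6 => { s with hi := z }
  | 7 => { s with wid := z }
  | 8 => { s with m := z }
  | 9 => { s with K := z }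
  | 10 => { s with L := z }
  | 11 => { s with p := z }
  | 12 => { s with d := z }
  | _ => s

/-- Assignment to an entry of an index array. -/
def setIA (s : Mem) (a i z : ℕ) : Mem :=
  match a with
  | 0 => { s with A := Function.update s.A i z }
  | 1 => { s with B := Function.update s.B i z }
  | 2 => { s with st := Function.update s.st i z }
  | _ => s

/-- Assignment to a real variable. -/
def setR (s : Mem) (x : ℕ) (z : ℝ) : Mem :=
  match x with
  | 0 => { s with eps := z }
  | 1 => { s with q := z }
  | 2 => { s with wj := z }
  | 3 => { s with acc := z }
  | 4 => { s with accw := z }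
  | 5 => { s with best := z }
  | _ => s

/-- Assignment to an entry of a real array. -/
def setRA (s : Mem) (a i : ℕ) (z : ℝ) : Mem :=
  match a with
  | 0 => { s with V := Function.update s.V i z }
  | 1 => { s with W := Function.update s.W i z }
  | 2 => { s with pw := Function.update s.pw i z }
  | 3 => { s with Y := Function.update s.Y i z }
  | 4 => { s with F := Function.update s.F i z }
  | 5 => { s with G := Function.update s.G i z }
  | 6 => { s with H := Function.update s.H i z }
  | _ => s

/-- The machine store that `s` describes; everything outside the named variables is `0`. -/
def store (s : Mem) : Store where
  ivar := s.getI
  iarr := s.getIA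
  rvar := s.getR
  rarr := s.getRA
  out := s.out

@[simp] theorem store_ivar (s : Mem) : s.store.ivar = s.getI := rfl
@[simp] theorem store_iarr (s : Mem) : s.store.iarr = s.getIA := rfl
@[simp] theorem store_rvar (s : Mem) : s.store.rvar = s.getR := rfl
@[simp] theorem store_rarr (s : Mem) : s.store.rarr = s.getRA := rfl

theorem store_setI (s : Mem) {x : ℕ} (z : ℕ) (hx : x < 13) :
    (s.setI x z).store = { s.store with ivar := Function.update s.store.ivar x z } := by
  have h : (s.setI x z).getI = Function.update s.getI x z := by
    funext y
    rw [Function.update_apply]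
    interval_cases x <;> (unfold getI setI; rcases y with _|_|_|_|_|_|_|_|_|_|_|_|_|y <;> simp)
  interval_cases x <;> simp only [store, ← h] <;> rfl

theorem store_setIA (s : Mem) {a : ℕ} (i z : ℕ) (ha : a < 3) :
    (s.setIA a i z).store = { s.store with iarr := put s.store.iarr a i z } := by
  have h : (s.setIA a i z).getIA = put s.getIA a i z := by
    funext y
    rw [put, Function.update_apply]
    interval_cases a <;> (unfold getIA setIA; rcases y with _|_|_|y <;> simp)
  interval_cases a <;> simp only [store, ← h] <;> rfl

theorem store_setR (s : Mem) {x : ℕ} (z : ℝ) (hx : x < 6) :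
    (s.setR x z).store = { s.store with rvar := Function.update s.store.rvar x z } := by
  have h : (s.setR x z).getR = Function.update s.getR x z := by
    funext y
    rw [Function.update_apply]
    interval_cases x <;> (unfold getR setR; rcases y with _|_|_|_|_|_|y <;> simp)
  interval_cases x <;> simp only [store, ← h] <;> rfl

theorem store_setRA (s : Mem) {a : ℕ} (i : ℕ) (z : ℝ) (ha : a < 7) :
    (s.setRA a i z).store = { s.store with rarr := put s.store.rarr a i z } := by
  have h : (s.setRA a i z).getRA = put s.getRA a i z := by
    funext y
    rw [put, Function.update_apply]
    interval_cases a <;> (unfold getRA setRA; rcases y with _|_|_|_|_|_|_|y <;> simp)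
  interval_cases a <;> simp only [store, ← h] <;> rfl

end Mem

/-- `wp p s Q`: started in `s`, the program `p` halts, and its running time `t` and final memory `s'`
satisfy `Q t s'`. Loop-free programs are executed symbolically by unfolding this definition; a loop
is left to `wp_for` and `wp_while`. Assignments to variables outside `Mem` are excluded. -/
def wp : Prog → Mem → (ℕ → Mem → Prop) → Prop
  | .skip, s, Q => Q 1 s
  | .setIndex x e, s, Q => x < 13 ∧ Q (e.cost + 1) (s.setI x (e.eval s.store))
  | .putIndex a i e, s, Q =>
      a < 3 ∧ Q (i.cost + e.cost + 1) (s.setIA a (i.eval s.store) (e.eval s.store))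
  | .setReal x e, s, Q => x < 6 ∧ Q (e.cost + 1) (s.setR x (e.eval s.store))
  | .putReal a i e, s, Q =>
      a < 7 ∧ Q (i.cost + e.cost + 1) (s.setRA a (i.eval s.store) (e.eval s.store))
  | .emit e₁ e₂, s, Q => Q (e₁.cost + e₂.cost + 1)
      { s with out := s.out ++ [(e₁.eval s.store, e₂.eval s.store)] }
  | .seq p q, s, Q => wp p s fun t s' => wp q s' fun t' s'' => Q (t + t') s''
  | .branch b p q, s, Q => (b.Holds s.store → wp p s fun t s' => Q (b.cost + t + 1) s') ∧
      (¬ b.Holds s.store → wp q s fun t s' => Q (b.cost + t + 1) s')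
  | .loop b p, s, Q => ∃ t s', Exec (.loop b p) s.store t (Mem.store s') ∧ Q t s'

theorem wp_sound {p : Prog} {s : Mem} {Q : ℕ → Mem → Prop} (h : wp p s Q) :
    ∃ t s', Exec p s.store t (Mem.store s') ∧ Q t s' := by
  induction p generalizing s Q with
  | skip => exact ⟨1, s, .skip _, h⟩
  | setIndex x e =>
    refine ⟨_, _, ?_, h.2⟩
    rw [Mem.store_setI _ _ h.1]
    exact .setIndex _ _ _
  | putIndex a i e =>
    refine ⟨_, _, ?_, h.2⟩
    rw [Mem.store_setIA _ _ _ h.1]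
    exact .putIndex _ _ _ _
  | setReal x e =>
    refine ⟨_, _, ?_, h.2⟩
    rw [Mem.store_setR _ _ h.1]
    exact .setReal _ _ _
  | putReal a i e =>
    refine ⟨_, _, ?_, h.2⟩
    rw [Mem.store_setRA _ _ _ h.1]
    exact .putReal _ _ _ _
  | emit e₁ e₂ => exact ⟨_, _, .emit _ _ _, h⟩
  | seq p q hp hq =>
    obtain ⟨t, s', h₁, h'⟩ := hp h
    obtain ⟨t', s'', h₂, h''⟩ := hq h'
    exact ⟨_, _, .seq h₁ h₂, h''⟩
  | branch b p q hp hq =>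
    by_cases hb : b.Holds s.store
    · obtain ⟨t, s', h₁, h'⟩ := hp (h.1 hb)
      exact ⟨_, _, .branch_true hb h₁, h'⟩
    · obtain ⟨t, s', h₁, h'⟩ := hq (h.2 hb)
      exact ⟨_, _, .branch_false hb h₁, h'⟩
  | loop b p _ => exact h

theorem wp_mono {p : Prog} {s : Mem} {Q Q' : ℕ → Mem → Prop} (h : wp p s Q)
    (hQ : ∀ t s', Q t s' → Q' t s') : wp p s Q' := by
  induction p generalizing s Q Q' with
  | skip => exact hQ _ _ h
  | setIndex x e => exact ⟨h.1, hQ _ _ h.2⟩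
  | putIndex a i e => exact ⟨h.1, hQ _ _ h.2⟩
  | setReal x e => exact ⟨h.1, hQ _ _ h.2⟩
  | putReal a i e => exact ⟨h.1, hQ _ _ h.2⟩
  | emit e₁ e₂ => exact hQ _ _ h
  | seq p q hp hq => exact hp h fun t s' h' => hq h' fun t' s'' => hQ _ _
  | branch b p q hp hq =>
    exact ⟨fun hb => hp (h.1 hb) fun t s' => hQ _ _, fun hb => hq (h.2 hb) fun t s' => hQ _ _⟩
  | loop b p _ =>
    obtain ⟨t, s', h₁, h'⟩ := h
    exact ⟨t, s', h₁, hQ _ _ h'⟩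

theorem wp_seq {p q : Prog} {s : Mem} {Q Q' : ℕ → Mem → Prop} (hp : wp p s Q)
    (hq : ∀ t s', Q t s' → wp q s' fun t' s'' => Q' (t + t') s'') : wp (.seq p q) s Q' :=
  wp_mono (p := p) hp hq

/-- Amortized rule for loops: `Φ` is a potential that pays for every iteration, including its test;
as a test costs at least one unit, `Φ` decreases and the loop ends. -/
theorem wp_while {b : BExp} {p : Prog} (Inv : Mem → Prop) (Φ : Mem → ℕ)
    (step : ∀ s, Inv s → b.Holds s.store →
      wp p s fun t s' => Inv s' ∧ t + b.cost + 1 + Φ s' ≤ Φ s)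
    (s : Mem) (hs : Inv s) :
    wp (.loop b p) s fun t s' => t + Φ s' ≤ Φ s + b.cost + 1 ∧ Inv s' ∧ ¬ b.Holds s'.store := by
  induction hN : Φ s using Nat.strong_induction_on generalizing s with
  | _ N ih =>
    subst hN
    by_cases hb : b.Holds s.store
    · obtain ⟨t, s', h₁, h₂, h₃⟩ := wp_sound (step s hs hb)
      obtain ⟨t', s'', h₄, h₅, h₆⟩ := ih (Φ s') (by omega) s' h₂ rfl
      exact ⟨_, _, .loop_true hb h₁ h₄, by omega, h₆⟩
    · exact ⟨_, _, .loop_false hb, by omega, hs, hb⟩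

/-- Rule for loops whose memory `f i` after `i` iterations is known explicitly. -/
theorem wp_for {b : BExp} {p : Prog} (f : ℕ → Mem) {lo hi : ℕ} (T : ℕ) (hle : lo ≤ hi)
    (hb : ∀ i, lo ≤ i → i < hi → b.Holds (f i).store) (hend : ¬ b.Holds (f hi).store)
    (step : ∀ i, lo ≤ i → i < hi → wp p (f i) fun t s' => t ≤ T ∧ s' = f (i + 1)) :
    wp (.loop b p) (f lo) fun t s' =>
      t ≤ (hi - lo) * (T + b.cost + 1) + b.cost + 1 ∧ s' = f hi := by
  induction hN : hi - lo generalizing lo with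
  | zero =>
    obtain rfl : lo = hi := by omega
    exact ⟨_, _, .loop_false hend, by omega, rfl⟩
  | succ N ih =>
    obtain ⟨t, s', h₁, h₂, rfl⟩ := wp_sound (step lo le_rfl (by omega))
    obtain ⟨t', s'', h₄, h₅, rfl⟩ := ih (lo := lo + 1) (by omega)
      (fun i hi => hb i (by omega)) (fun i hi => step i (by omega)) (by omega)
    exact ⟨_, _, .loop_true (hb lo le_rfl (by omega)) h₁ h₄, by rw [Nat.succ_mul]; omega, rfl⟩


attribute [simp] wp IExp.eval IExp.cost RExp.eval RExp.cost BExp.Holds BExp.cost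
  Mem.getI Mem.getIA Mem.getR Mem.getRA Mem.setI Mem.setIA Mem.setR Mem.setRA

end RealRAM

namespace RealRAM

/-! ### Merge sort -/

section Segments

variable {α : Type*}

/-- The entries `A lo, …, A (hi - 1)` as a list. -/
def seg (A : ℕ → α) (lo hi : ℕ) : List α := (List.range' lo (hi - lo)).map A

theorem seg_self (A : ℕ → α) {lo hi : ℕ} (h : hi ≤ lo) : seg A lo hi = [] := by
  simp [seg, Nat.sub_eq_zero_of_le h]

theorem seg_cons (A : ℕ → α) {lo hi : ℕ} (h : lo < hi) :
    seg A lo hi = A lo :: seg A (lo + 1) hi := by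
  obtain ⟨d, rfl⟩ : ∃ d, hi = lo + (d + 1) := ⟨hi - lo - 1, by omega⟩
  simp only [seg, Nat.add_sub_cancel_left, show lo + (d + 1) - (lo + 1) = d by omega,
    List.range'_succ, List.map_cons]

theorem seg_append (A : ℕ → α) {lo mid hi : ℕ} (h : lo ≤ mid) (h' : mid ≤ hi) :
    seg A lo mid ++ seg A mid hi = seg A lo hi := by
  obtain ⟨a, rfl⟩ := Nat.exists_eq_add_of_le h
  obtain ⟨b, rfl⟩ := Nat.exists_eq_add_of_le h'
  simp only [seg, ← List.map_append, Nat.add_sub_cancel_left,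
    show lo + a + b - lo = a + b by omega]
  rw [← List.range'_append_1]

theorem seg_snoc (A : ℕ → α) {lo hi : ℕ} (h : lo ≤ hi) :
    seg A lo (hi + 1) = seg A lo hi ++ [A hi] := by
  rw [← seg_append A h hi.le_succ, seg_cons A hi.lt_succ_self, seg_self A le_rfl]

theorem seg_congr {A B : ℕ → α} {lo hi : ℕ} (h : ∀ x, lo ≤ x → x < hi → A x = B x) :
    seg A lo hi = seg B lo hi := by
  apply List.map_congr_left
  intro x hx
  rw [List.mem_range'_1] at hx
  exact h x (by omega) (by omega)

theorem pairwise_seg {A : ℕ → α} {R : α → α → Prop} {lo hi : ℕ} :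
    (seg A lo hi).Pairwise R ↔ ∀ x y, lo ≤ x → x < y → y < hi → R (A x) (A y) := by
  constructor
  · intro h x y h₁ h₂ h₃
    have := List.pairwise_iff_getElem.1 h (x - lo) (y - lo) (by simp [seg]; omega)
      (by simp [seg]; omega) (by omega)
    simpa [seg, show lo + (x - lo) = x by omega, show lo + (y - lo) = y by omega] using this
  · intro h
    rw [seg, List.pairwise_map]
    refine List.Pairwise.imp_of_mem ?_ List.pairwise_lt_range'
    intro x y hx hy hxy
    rw [List.mem_range'_1] at hx hy
    exact h x y (by omega) hxy (by omega)

end Segments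

/-- The order in which items are processed: by increasing weight, and by decreasing value among
items of equal weight. -/
def Precedes (V W : ℕ → ℝ) (a b : ℕ) : Prop := W a ≤ W b ∧ ¬ (W b ≤ W a ∧ ¬ V b ≤ V a)

theorem Precedes.trans {V W : ℕ → ℝ} {a b c : ℕ} (h : Precedes V W a b) (h' : Precedes V W b c) :
    Precedes V W a c := by
  refine ⟨h.1.trans h'.1, fun hc => ?_⟩
  have h₁ := h.2
  have h₂ := h'.2
  push Not at h₁ h₂
  exact hc.2 ((h₂ (hc.1.trans h.1)).trans (h₁ (h'.1.trans hc.1)))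

theorem Precedes.total (V W : ℕ → ℝ) (a b : ℕ) : Precedes V W a b ∨ Precedes V W b a := by
  unfold Precedes
  rcases lt_trichotomy (W a) (W b) with h | h | h
  · exact .inl ⟨h.le, fun h' => absurd h'.1 (not_le.2 h)⟩
  · rcases le_total (V a) (V b) with h' | h'
    · exact .inr ⟨h.ge, fun h'' => h''.2 h'⟩
    · exact .inl ⟨h.le, fun h'' => h''.2 h'⟩
  · exact .inr ⟨h.le, fun h' => absurd h'.1 (not_le.2 h)⟩

open Classical in
/-- `Precedes` as a Boolean comparison, for use with `List.merge`. -/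
noncomputable def precedes (V W : ℕ → ℝ) (a b : ℕ) : Bool := decide (Precedes V W a b)

theorem precedes_iff {V W : ℕ → ℝ} {a b : ℕ} : precedes V W a b = true ↔ Precedes V W a b := by
  simp [precedes]

/-- The test `Precedes` for two items given by index expressions. -/
def precedesExp (x y : IExp) : BExp :=
  .conj (.rle (.get 1 x) (.get 1 y))
    (.neg (.conj (.rle (.get 1 y) (.get 1 x)) (.neg (.rle (.get 0 y) (.get 0 x)))))

@[simp] theorem holds_precedesExp (s : Mem) (x y : IExp) : (precedesExp x y).Holds s.store ↔
    Precedes s.V s.W (x.eval s.store) (y.eval s.store) := Iff.rfl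

@[simp] theorem cost_precedesExp (x y : IExp) :
    (precedesExp x y).cost = 3 * x.cost + 3 * y.cost + 13 := by
  simp [precedesExp]
  ring

/-- One step of merging `A[lo, mid)` and `A[mid, hi)`: the next item goes to position `k` of `B`. -/
def mergeStep : Prog :=
  .seq (.branch
    (.conj (.neg (.ile (.var 5) (.var 1)))
      (.neg (.conj (.neg (.ile (.var 6) (.var 2)))
        (.neg (precedesExp (.get 0 (.var 1)) (.get 0 (.var 2)))))))
    (.seq (.putIndex 1 (.var 3) (.get 0 (.var 1))) (.setIndex 1 (.add (.var 1) (.const 1))))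
    (.seq (.putIndex 1 (.var 3) (.get 0 (.var 2))) (.setIndex 2 (.add (.var 2) (.const 1)))))
    (.setIndex 3 (.add (.var 3) (.const 1)))

/-- Merges `A[lo, mid)` and `A[mid, hi)` into `B[lo, hi)`. -/
def mergeLoop : Prog := .loop (.neg (.ile (.var 6) (.var 3))) mergeStep

theorem seg_update_snoc {α : Type*} (B : ℕ → α) {lo k : ℕ} (h : lo ≤ k) (x : α) :
    seg (Function.update B k x) lo (k + 1) = seg B lo k ++ [x] := by
  rw [seg_snoc _ h, Function.update_self]
  congr 1
  refine seg_congr fun y _ hy => Function.update_of_ne (by omega) _ _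

theorem wp_mergeLoop (s : Mem) (hi : s.i = s.lo) (hj : s.j = s.mid) (hk : s.k = s.lo)
    (h₁ : s.lo ≤ s.mid) (h₂ : s.mid ≤ s.hi) :
    wp mergeLoop s fun t s' => t ≤ (s.hi - s.lo) * 70 + 5 ∧ ∃ i j k B,
      s' = { s with i := i, j := j, k := k, B := B } ∧ (∀ x < s.lo, B x = s.B x) ∧
      seg B s.lo s.hi =
        List.merge (seg s.A s.lo s.mid) (seg s.A s.mid s.hi) (precedes s.V s.W) := by
  refine wp_mono (wp_while (fun s' => ∃ i j k B,
      s' = { s with i := i, j := j, k := k, B := B } ∧ (∀ x < s.lo, B x = s.B x) ∧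
      s.lo ≤ i ∧ i ≤ s.mid ∧ s.mid ≤ j ∧ j ≤ s.hi ∧ k + s.mid = i + j ∧
      seg B s.lo k ++ List.merge (seg s.A i s.mid) (seg s.A j s.hi) (precedes s.V s.W) =
        List.merge (seg s.A s.lo s.mid) (seg s.A s.mid s.hi) (precedes s.V s.W))
      (fun s' => (s.hi - s'.k) * 70) ?_ s ?_) ?_
  · rintro _ ⟨i, j, k, B, rfl, hB, hi₁, hi₂, hj₁, hj₂, hk, hm⟩ hlt
    simp at hlt
    by_cases hb : i < s.mid ∧ (j < s.hi → Precedes s.V s.W (s.A i) (s.A j))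
    · refine wp_mono (Q := fun t s' => t ≤ 60 ∧ s' =
        { s with i := i + 1, j := j, k := k + 1, B := Function.update B k (s.A i) }) ?_ ?_
      · clear hm hB
        simp [mergeStep]
        grind
      rintro t _ ⟨ht, rfl⟩
      refine ⟨⟨i + 1, j, k + 1, _, rfl, ?_, by omega, by omega, by omega, by omega, by omega, ?_⟩,
        by simp; omega⟩
      · intro x hx
        rw [Function.update_of_ne (by omega), hB x hx]
      · rw [seg_update_snoc _ (by omega), ← hm, seg_cons s.A hb.1, List.append_assoc,
          List.singleton_append]
        by_cases hj : j < s.hi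
        · rw [seg_cons s.A hj, List.cons_merge_cons_pos]
          exact precedes_iff.2 (hb.2 hj)
        · rw [seg_self s.A (by omega : s.hi ≤ j)]
          simp
    · refine wp_mono (Q := fun t s' => t ≤ 60 ∧ s' =
        { s with i := i, j := j + 1, k := k + 1, B := Function.update B k (s.A j) }) ?_ ?_
      · clear hm hB
        simp [mergeStep]
        grind
      rintro t _ ⟨ht, rfl⟩
      have hj : j < s.hi := by
        by_contra hj
        exact hb ⟨by omega, fun h => absurd h hj⟩
      refine ⟨⟨i, j + 1, k + 1, _, rfl, ?_, by omega, by omega, by omega, by omega, by omega, ?_⟩,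
        by simp; omega⟩
      · intro x hx
        rw [Function.update_of_ne (by omega), hB x hx]
      · rw [seg_update_snoc _ (by omega), ← hm, seg_cons s.A hj, List.append_assoc,
          List.singleton_append]
        by_cases hi : i < s.mid
        · rw [seg_cons s.A hi, List.cons_merge_cons_neg]
          exact fun h => hb ⟨hi, fun _ => precedes_iff.1 h⟩
        · rw [seg_self s.A (by omega : s.mid ≤ i)]
          simp
  · refine ⟨s.i, s.j, s.k, s.B, rfl, fun _ _ => rfl, by omega, by omega, by omega, by omega,
      by omega, ?_⟩
    rw [hi, hj, hk, seg_self s.B le_rfl, List.nil_append]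
  · rintro t _ ⟨ht, ⟨i, j, k, B, rfl, hB, hi₁, hi₂, hj₁, hj₂, hk', hm⟩, hge⟩
    simp at hge
    refine ⟨?_, i, j, k, B, rfl, hB, ?_⟩
    · simp [hk] at ht
      omega
    · obtain rfl : i = s.mid := by omega
      obtain rfl : j = s.hi := by omega
      obtain rfl : k = s.hi := by omega
      rw [← hm, seg_self s.A le_rfl, seg_self s.A le_rfl]
      simp

/-- Every block `[b * w, (b + 1) * w)` of the first `n` entries of `A` is sorted. -/
def SortedBlocks (R : ℕ → ℕ → Prop) (A : ℕ → ℕ) (w n : ℕ) : Prop :=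
  ∀ b x y, b * w ≤ x → x < y → y < b * w + w → y < n → R (A x) (A y)

/-- Sets the bounds `lo ≤ mid ≤ hi` of a pair of blocks of width `wid`, cut off at `n`, and the
pointers for merging them. -/
def setBounds : Prog :=
  .seq (.setIndex 5 (.add (.var 4) (.var 7))) <|
  .seq (.branch (.ile (.var 0) (.var 5)) (.setIndex 5 (.var 0)) .skip) <|
  .seq (.setIndex 6 (.add (.var 5) (.var 7))) <|
  .seq (.branch (.ile (.var 0) (.var 6)) (.setIndex 6 (.var 0)) .skip) <|
  .seq (.setIndex 1 (.var 4)) <|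
  .seq (.setIndex 2 (.var 5)) <|
  .setIndex 3 (.var 4)

/-- Merges the pair of blocks of width `wid` that starts at `lo`, and moves `lo` to the next pair. -/
def mergeBlocks : Prog :=
  .seq setBounds <|
  .seq mergeLoop <|
  .setIndex 4 (.add (.add (.var 4) (.var 7)) (.var 7))

/-- The cost is given as the decrease of the potential `(n - lo) * 130`, up to the `5` units that
the test of the surrounding loop takes. -/
theorem wp_mergeBlocks (s : Mem) (hlo : s.lo < s.n) (hw : 0 < s.wid) :
    wp mergeBlocks s fun t s' => t + 5 + (s.n - (s.lo + 2 * s.wid)) * 130 ≤ (s.n - s.lo) * 130 ∧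
      ∃ i j k mid hi B,
      s' = { s with i := i, j := j, k := k, lo := s.lo + 2 * s.wid, mid := mid, hi := hi, B := B } ∧
      (∀ x < s.lo, B x = s.B x) ∧
      seg B s.lo (min (s.lo + 2 * s.wid) s.n) =
        List.merge (seg s.A s.lo (min (s.lo + s.wid) s.n))
          (seg s.A (min (s.lo + s.wid) s.n) (min (s.lo + 2 * s.wid) s.n)) (precedes s.V s.W) := by
  obtain ⟨mid, hmid⟩ : ∃ x, x = min (s.lo + s.wid) s.n := ⟨_, rfl⟩
  obtain ⟨hi, hhi⟩ : ∃ x, x = min (s.lo + 2 * s.wid) s.n := ⟨_, rfl⟩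
  have pre : wp setBounds s fun t s' => t ≤ 36 ∧
      s' = { s with i := s.lo, j := mid, k := s.lo, mid := mid, hi := hi } := by
    simp [setBounds]
    grind
  refine wp_seq pre ?_
  rintro t₁ _ ⟨ht₁, rfl⟩
  refine wp_seq (wp_mergeLoop _ rfl rfl rfl (by simp; omega) (by simp; omega)) ?_
  rintro t₂ _ ⟨ht₂, i, j, k, B, rfl, hB, hm⟩
  refine wp_mono (Q := fun t s' => t ≤ 6 ∧ s' = { s with
    i := i, j := j, k := k, lo := s.lo + 2 * s.wid, mid := mid, hi := hi, B := B }) ?_ ?_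
  · simp; omega
  rintro t₃ _ ⟨ht₃, rfl⟩
  simp only at ht₂ hB hm
  refine ⟨by omega, i, j, k, mid, hi, B, rfl, hB, ?_⟩
  rw [← hmid, ← hhi, hm]

/-- One pass of merge sort from `A` to `B` and back to `A`, which doubles the width of the sorted
blocks. -/
def mergePass : Prog :=
  .seq (.setIndex 4 (.const 0)) <|
  .seq (.loop (.neg (.ile (.var 0) (.var 4))) mergeBlocks) <|
  .seq (.setIndex 1 (.const 0)) <|
  .seq (.loop (.neg (.ile (.var 0) (.var 1)))
    (.seq (.putIndex 0 (.var 1) (.get 1 (.var 1))) (.setIndex 1 (.add (.var 1) (.const 1))))) <|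
  .setIndex 7 (.add (.var 7) (.var 7))

theorem wp_mergePass (s : Mem) (hw : 0 < s.wid)
    (hs : SortedBlocks (Precedes s.V s.W) s.A s.wid s.n) :
    wp mergePass s fun t s' => t ≤ s.n * 150 + 30 ∧ ∃ i j k lo mid hi A B,
      s' = { s with
        i := i, j := j, k := k, lo := lo, mid := mid, hi := hi, wid := 2 * s.wid, A := A, B := B } ∧
      (seg A 0 s.n).Perm (seg s.A 0 s.n) ∧
      SortedBlocks (Precedes s.V s.W) A (2 * s.wid) s.n := by
  simp only [mergePass, wp, IExp.cost, Mem.setI, IExp.eval]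
  refine ⟨by norm_num, wp_mono (wp_while (fun s' => ∃ i j k mid hi B b, s' = { s with
      i := i, j := j, k := k, lo := b * (2 * s.wid), mid := mid, hi := hi, B := B } ∧
      (seg B 0 (min (b * (2 * s.wid)) s.n)).Perm (seg s.A 0 (min (b * (2 * s.wid)) s.n)) ∧
      SortedBlocks (Precedes s.V s.W) B (2 * s.wid) (min (b * (2 * s.wid)) s.n))
      (fun s' => (s.n - s'.lo) * 130) ?_ _ ?_) ?_⟩
  · rintro _ ⟨i, j, k, mid, hi, B, b, rfl, hB, hS⟩ hlt
    simp at hlt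
    refine wp_mono (wp_mergeBlocks _ hlt hw) ?_
    rintro t _ ⟨ht, i, j, k, mid, hi, B', rfl, hB', hm⟩
    simp only at ht hB' hm ⊢
    have hb : (b + 1) * (2 * s.wid) = b * (2 * s.wid) + 2 * s.wid := by ring
    refine ⟨⟨i, j, k, mid, hi, B', b + 1, by rw [hb], ?_, ?_⟩, by
      simp only [BExp.cost, IExp.cost]; omega⟩
    · rw [hb, ← seg_append B' (Nat.zero_le (b * (2 * s.wid))) (by omega),
        ← seg_append s.A (Nat.zero_le (b * (2 * s.wid))) (by omega)]
      refine List.Perm.append ?_ ?_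
      · rw [Nat.min_eq_left hlt.le] at hB
        rwa [seg_congr fun x _ hx => hB' x hx]
      · rw [hm, ← seg_append s.A (lo := b * (2 * s.wid)) (mid := min (b * (2 * s.wid) + s.wid) s.n)
          (hi := min (b * (2 * s.wid) + 2 * s.wid) s.n) (by omega) (by omega)]
        exact List.merge_perm_append _
    · rw [hb]
      intro b' x y h₁ h₂ h₃ h₄
      rcases lt_trichotomy b' b with hbb | rfl | hbb
      · have := Nat.mul_le_mul_right (2 * s.wid) hbb
        rw [Nat.succ_mul] at this
        rw [hB' x (by omega), hB' y (by omega)]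
        exact hS b' x y h₁ h₂ h₃ (by omega)
      · have hp : (seg B' (b' * (2 * s.wid)) (min (b' * (2 * s.wid) + 2 * s.wid) s.n)).Pairwise
            (Precedes s.V s.W) := by
          have hP : Precedes s.V s.W = fun a b => precedes s.V s.W a b = true := by
            funext a b
            rw [precedes_iff]
          rw [hm, hP]
          refine List.pairwise_merge ?_ ?_ _ _ ?_ ?_
          · simp only [precedes_iff]
            exact fun a b c => Precedes.trans
          · simp only [Bool.or_eq_true, precedes_iff]
            exact Precedes.total _ _
          · rw [← hP]
            refine pairwise_seg.2 fun x y h₁ h₂ h₃ => hs (b' * 2) x y ?_ h₂ ?_ (by omega)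
            · rw [mul_assoc]; omega
            · rw [mul_assoc]; omega
          · rw [← hP]
            refine pairwise_seg.2 fun x y h₁ h₂ h₃ => hs (b' * 2 + 1) x y ?_ h₂ ?_ (by omega)
            · rw [add_mul, mul_assoc]; omega
            · rw [add_mul, mul_assoc]; omega
        exact pairwise_seg.1 hp x y h₁ h₂ h₄
      · have := Nat.mul_le_mul_right (2 * s.wid) hbb
        rw [Nat.succ_mul] at this
        omega
  · refine ⟨s.i, s.j, s.k, s.mid, s.hi, s.B, 0, by simp, by simp [seg_self], ?_⟩
    intro b x y _ _ _ h
    simp at h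
  · rintro t₁ _ ⟨ht₁, ⟨i, j, k, mid, hi, B, b, rfl, hB, hS⟩, hge⟩
    simp at hge ht₁
    rw [Nat.min_eq_right hge] at hB hS
    refine ⟨by norm_num, wp_mono (wp_for (fun x => { s with
      i := x, j := j, k := k, lo := b * (2 * s.wid), mid := mid, hi := hi, B := B,
      A := fun y => if y < x then B y else s.A y }) (lo := 0) (hi := s.n) 12 (Nat.zero_le _)
      (by simp) (by simp) ?_) ?_⟩
    · intro x _ hx
      simp
      funext y
      rw [Function.update_apply]
      grind
    · rintro t₂ _ ⟨ht₂, rfl⟩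
      simp only [BExp.cost, IExp.cost] at ht₂
      refine ⟨by norm_num, by omega, s.n, j, k, b * (2 * s.wid), mid, hi, _, B,
        by simp only [two_mul]; rfl, ?_, ?_⟩
      · rwa [seg_congr (B := B) fun y _ hy => by simp [hy]]
      · intro b x y h₁ h₂ h₃ h₄
        simp only [h₄, h₂.trans h₄, if_true]
        exact hS b x y h₁ h₂ h₃ h₄

/-- Bottom-up merge sort of the items: `A` lists them in the order `Precedes`. -/
def sortItems : Prog :=
  .seq (.setIndex 1 (.const 0)) <|
  .seq (.loop (.neg (.ile (.var 0) (.var 1)))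
    (.seq (.putIndex 0 (.var 1) (.var 1)) (.setIndex 1 (.add (.var 1) (.const 1))))) <|
  .seq (.setIndex 7 (.const 1)) <|
  .loop (.neg (.ile (.var 0) (.var 7))) mergePass

theorem wp_sortItems (s : Mem) :
    wp sortItems s fun t s' => t ≤ (s.n * 150 + 40) * (Nat.clog 2 s.n + 2) ∧
      ∃ i j k lo mid hi wid A B, s' = { s with
        i := i, j := j, k := k, lo := lo, mid := mid, hi := hi, wid := wid, A := A, B := B } ∧
      (seg A 0 s.n).Perm (List.range s.n) ∧
      ∀ x y, x < y → y < s.n → Precedes s.V s.W (A x) (A y) := by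
  simp only [sortItems, wp, IExp.cost, Mem.setI, IExp.eval]
  refine ⟨by norm_num, wp_mono (wp_for (fun x => { s with
      i := x, A := fun y => if y < x then y else s.A y }) (lo := 0) (hi := s.n) 12 (Nat.zero_le _)
      (by simp) (by simp) ?_) ?_⟩
  · intro x _ hx
    simp
    funext y
    rw [Function.update_apply]
    grind
  rintro t₁ _ ⟨ht₁, rfl⟩
  simp only [BExp.cost, IExp.cost] at ht₁
  refine ⟨by norm_num, wp_mono (wp_while (fun s' => ∃ i j k lo mid hi A B b, s' = { s with
      i := i, j := j, k := k, lo := lo, mid := mid, hi := hi, wid := 2 ^ b, A := A, B := B } ∧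
      (seg A 0 s.n).Perm (List.range s.n) ∧ SortedBlocks (Precedes s.V s.W) A (2 ^ b) s.n)
      (fun s' => (s.n * 150 + 40) * (Nat.clog 2 s.n - Nat.log 2 s'.wid)) ?_ _ ?_) ?_⟩
  · rintro _ ⟨i, j, k, lo, mid, hi, A, B, b, rfl, hA, hS⟩ hlt
    simp at hlt
    refine wp_mono (wp_mergePass _ (by simp) hS) ?_
    rintro t _ ⟨ht, i, j, k, lo, mid, hi, A', B', rfl, hA', hS'⟩
    simp only at ht hA' hS' ⊢
    rw [← pow_succ'] at *
    refine ⟨⟨i, j, k, lo, mid, hi, A', B', b + 1, rfl, hA'.trans hA, hS'⟩, ?_⟩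
    rw [Nat.log_pow one_lt_two, Nat.log_pow one_lt_two]
    have hb : b < Nat.clog 2 s.n := (Nat.lt_clog_iff_pow_lt one_lt_two).2 hlt
    obtain ⟨c, hc⟩ : ∃ c, Nat.clog 2 s.n = b + 1 + c := Nat.exists_eq_add_of_le hb
    rw [hc, show b + 1 + c - (b + 1) = c by omega, show b + 1 + c - b = c + 1 by omega, mul_add]
    simp
    omega
  · refine ⟨s.n, s.j, s.k, s.lo, s.mid, s.hi, _, s.B, 0, rfl, ?_, ?_⟩
    · rw [seg_congr (B := id) fun y _ hy => by simp [hy]]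
      simp [seg, List.range_eq_range']
    · intro b x y _ _ _ _
      omega
  · rintro t₂ _ ⟨ht₂, ⟨i, j, k, lo, mid, hi, A, B, b, rfl, hA, hS⟩, hge⟩
    simp at hge ht₂
    refine ⟨?_, i, j, k, lo, mid, hi, _, A, B, rfl, hA, ?_⟩
    · rw [mul_add]
      omega
    · intro x y h₁ h₂
      exact hS 0 x y (by simp) h₁ (by omega) h₂

end RealRAM

namespace Knapsack

/-! ### Geometric grids of budgets and convolution on them -/

/-- The grid of budgets: `0`, and then the geometric progression `w₀, w₀ q, w₀ q², …`. -/
noncomputable def grid (w₀ q : ℝ) (k : ℕ) : ℝ := if k = 0 then 0 else w₀ * q ^ (k - 1)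

/-- The least `s` for which a budget that lies `s` steps below a grid point and one that lies `d`
steps below it fit together into it, cut off at `K`. By scale invariance of the grid, `s` does not
depend on the grid point. -/
noncomputable def shift (q : ℝ) (K d : ℕ) : ℕ :=
  sInf {s : ℕ | K ≤ s ∨ 1 / q ^ s + 1 / q ^ d ≤ 1}

/-- The best combination of a budget for `F` and one for `G` that fit together into the grid point
`k`, where the larger of the two budgets is less than `D` steps below `k`. As subtraction is
truncated, all steps below the grid lead to the budget `0`. -/
noncomputable def conv (st : ℕ → ℕ) (F G : ℕ → ℝ) (k : ℕ) : ℕ → ℝ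
  | 0 => 0
  | d + 1 => max (max (conv st F G k d) (F (k - d) + G (k - st d))) (F (k - st d) + G (k - d))

section Grid

variable {w₀ q : ℝ} {K : ℕ}

@[simp] theorem grid_zero : grid w₀ q 0 = 0 := by simp [grid]

@[simp] theorem grid_succ (k : ℕ) : grid w₀ q (k + 1) = w₀ * q ^ k := by simp [grid]

theorem grid_nonneg (hw : 0 < w₀) (hq : 1 < q) (k : ℕ) : 0 ≤ grid w₀ q k := by
  rcases k with _ | k
  · simp
  · rw [grid_succ]; positivity

theorem grid_strictMono (hw : 0 < w₀) (hq : 1 < q) : StrictMono (grid w₀ q) := by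
  refine strictMono_nat_of_lt_succ fun k => ?_
  rcases k with _ | k
  · simpa using hw
  · rw [grid_succ, grid_succ]
    exact mul_lt_mul_of_pos_left (pow_lt_pow_right₀ hq k.lt_succ_self) hw

theorem shift_spec (q : ℝ) (K d : ℕ) : K ≤ shift q K d ∨ 1 / q ^ shift q K d + 1 / q ^ d ≤ 1 :=
  Nat.sInf_mem (s := {s : ℕ | K ≤ s ∨ 1 / q ^ s + 1 / q ^ d ≤ 1}) ⟨K, .inl le_rfl⟩

theorem shift_le {d s : ℕ} (h : K ≤ s ∨ 1 / q ^ s + 1 / q ^ d ≤ 1) : shift q K d ≤ s :=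
  Nat.sInf_le h

theorem grid_sub_eq (hw : 0 < w₀) (hq : 1 < q) {a k : ℕ} (h : a < k) :
    grid w₀ q (k - a) = grid w₀ q k * (1 / q ^ a) := by
  obtain ⟨b, rfl⟩ : ∃ b, k = a + b + 1 := ⟨k - a - 1, by omega⟩
  rw [show a + b + 1 - a = b + 1 by omega, grid_succ, grid_succ, pow_add]
  have : q ^ a ≠ 0 := by positivity
  field_simp

/-- All combinations that `conv` looks at respect the budget. -/
theorem grid_add_shift_le (hw : 0 < w₀) (hq : 1 < q) {k : ℕ} (hk : k ≤ K) (d : ℕ) :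
    grid w₀ q (k - d) + grid w₀ q (k - shift q K d) ≤ grid w₀ q k := by
  have hm := (grid_strictMono hw hq).monotone
  rcases le_or_gt k d with h | h
  · rw [Nat.sub_eq_zero_of_le h, grid_zero, zero_add]
    exact hm (Nat.sub_le _ _)
  rcases le_or_gt k (shift q K d) with h' | h'
  · rw [Nat.sub_eq_zero_of_le h', grid_zero, add_zero]
    exact hm (Nat.sub_le _ _)
  rw [grid_sub_eq hw hq h, grid_sub_eq hw hq h', ← mul_add]
  rcases shift_spec q K d with hs | hs
  · omega
  · exact mul_le_of_le_one_right (grid_nonneg hw hq k) (by linarith)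

/-- Every pair of budgets that fit together into the grid point `k` is dominated by a pair that
`conv` looks at: if both budgets are at most half of `grid w₀ q k`, the larger one may be increased
to `L` steps below `k`. -/
theorem exists_shift (hw : 0 < w₀) (hq : 1 < q) {L a b k : ℕ} (hL : 2 ≤ q ^ L)
    (hab : a ≤ b) (h : grid w₀ q a + grid w₀ q b ≤ grid w₀ q k) :
    ∃ d ≤ L, b ≤ k - d ∧ a ≤ k - shift q K d := by
  have hmono := grid_strictMono hw hq
  have hbk : b ≤ k := hmono.le_iff_le.1 (by linarith [grid_nonneg hw hq a])
  rcases Nat.eq_zero_or_pos a with rfl | ha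
  · by_cases hd : k - b ≤ L
    · exact ⟨k - b, hd, by omega, by omega⟩
    · exact ⟨L, le_rfl, by omega, by omega⟩
  by_cases hd : k - b ≤ L
  · refine ⟨k - b, hd, by omega, ?_⟩
    have : shift q K (k - b) ≤ k - a := by
      refine shift_le (.inr ?_)
      have hpos : 0 < grid w₀ q k := by
        simpa using hmono (show 0 < k by omega)
      have h₁ := grid_sub_eq (w₀ := w₀) (a := k - a) (k := k) hw hq (by omega)
      have h₂ := grid_sub_eq (w₀ := w₀) (a := k - b) (k := k) hw hq (by omega)
      rw [show k - (k - a) = a by omega] at h₁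
      rw [show k - (k - b) = b by omega] at h₂
      rw [h₁, h₂, ← mul_add] at h
      exact le_of_mul_le_mul_left (by linarith) hpos
    omega
  · refine ⟨L, le_rfl, by omega, ?_⟩
    have : shift q K L ≤ L := by
      refine shift_le (.inr ?_)
      have : 1 / q ^ L ≤ 1 / 2 := one_div_le_one_div_of_le two_pos hL
      linarith
    omega

/-- Rounding up to the grid loses at most a factor `q`. -/
theorem exists_grid (hw : 0 < w₀) (hq : 1 < q) {x : ℝ} (hx : x = 0 ∨ w₀ ≤ x)
    (hK : x ≤ grid w₀ q K) : ∃ a ≤ K, x ≤ grid w₀ q a ∧ grid w₀ q a ≤ q * x := by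
  classical
  have hex : ∃ a, x ≤ grid w₀ q a := ⟨K, hK⟩
  have hx0 : 0 ≤ x := by rcases hx with h | h <;> linarith
  refine ⟨Nat.find hex, Nat.find_min' hex hK, Nat.find_spec hex, ?_⟩
  rcases ha : Nat.find hex with _ | _ | a
  · simp only [grid_zero]; positivity
  · have := Nat.find_min hex (show 0 < Nat.find hex by omega)
    rw [grid_zero] at this
    rw [grid_succ, pow_zero, mul_one]
    rcases hx with h | h
    · exact absurd h.le this
    · nlinarith
  · have := Nat.find_min hex (show a + 1 < Nat.find hex by omega)
    rw [grid_succ, not_le] at this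
    rw [grid_succ, pow_succ]
    nlinarith

end Grid

section Conv

variable {st : ℕ → ℕ} {F G : ℕ → ℝ}

/-- Every property of `0` and of the values that `conv` compares holds for `conv`. -/
theorem conv_induction (P : ℝ → Prop) {k D : ℕ} (h₀ : P 0)
    (h₁ : ∀ d < D, P (F (k - d) + G (k - st d))) (h₂ : ∀ d < D, P (F (k - st d) + G (k - d))) :
    P (conv st F G k D) := by
  induction D with
  | zero => exact h₀
  | succ D ih =>
    have ih := ih (fun d hd => h₁ d (by omega)) (fun d hd => h₂ d (by omega))
    rw [conv]
    rcases max_choice (max (conv st F G k D) (F (k - D) + G (k - st D)))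
      (F (k - st D) + G (k - D)) with h | h
    · rw [h]
      rcases max_choice (conv st F G k D) (F (k - D) + G (k - st D)) with h | h <;> rw [h]
      exacts [ih, h₁ D D.lt_succ_self]
    · rw [h]
      exact h₂ D D.lt_succ_self

theorem le_conv {k d D : ℕ} (hd : d < D) :
    F (k - d) + G (k - st d) ≤ conv st F G k D ∧ F (k - st d) + G (k - d) ≤ conv st F G k D := by
  induction D with
  | zero => omega
  | succ D ih =>
    rw [conv]
    rcases Nat.lt_succ_iff_lt_or_eq.1 hd with h | rfl
    · exact ⟨(ih h).1.trans ((le_max_left _ _).trans (le_max_left _ _)),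
        (ih h).2.trans ((le_max_left _ _).trans (le_max_left _ _))⟩
    · exact ⟨(le_max_right _ _).trans (le_max_left _ _), le_max_right _ _⟩

theorem conv_congr {st' : ℕ → ℕ} {k D : ℕ} (h : ∀ d < D, st d = st' d) :
    conv st F G k D = conv st' F G k D := by
  induction D with
  | zero => rfl
  | succ D ih => rw [conv, conv, ih fun d hd => h d (by omega), h D D.lt_succ_self]

theorem conv_monotoneOn {K : ℕ} (hF : MonotoneOn F (Set.Iic K)) (hG : MonotoneOn G (Set.Iic K))
    (D : ℕ) : MonotoneOn (fun k => conv st F G k D) (Set.Iic K) := by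
  intro k hk k' hk' hkk
  simp only [Set.mem_Iic] at hk hk'
  have hF' (d : ℕ) : F (k - d) ≤ F (k' - d) :=
    hF (Set.mem_Iic.2 (by omega)) (Set.mem_Iic.2 (by omega)) (by omega)
  have hG' (d : ℕ) : G (k - d) ≤ G (k' - d) :=
    hG (Set.mem_Iic.2 (by omega)) (Set.mem_Iic.2 (by omega)) (by omega)
  induction D with
  | zero => exact le_rfl
  | succ D ih =>
    exact max_le_max (max_le_max ih (add_le_add (hF' _) (hG' _))) (add_le_add (hF' _) (hG' _))

end Conv

/-- `F` approximates, at the grid points up to `K`, the optimal value of the knapsack problem with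
the items of `I`: `F k` does not exceed what the budget `Y k` allows, and it is at least what the
budget `Y k / c` allows. -/
structure Approx (v w : ℕ → ℝ) (Y : ℕ → ℝ) (K : ℕ) (I : Finset ℕ) (c : ℝ) (F : ℕ → ℝ) : Prop where
  sound : ∀ k ≤ K, ∃ S ⊆ I, ∑ i ∈ S, w i ≤ Y k ∧ F k ≤ ∑ i ∈ S, v i
  complete : ∀ k ≤ K, ∀ S ⊆ I, c * ∑ i ∈ S, w i ≤ Y k → ∑ i ∈ S, v i ≤ F k
  mono : MonotoneOn F (Set.Iic K)

/-- A convolution costs only one more factor `q` of accuracy: that of rounding the budgets of the two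
parts of a selection up to the grid. The hypothesis on the weights is what makes rounding possible,
as the grid has no points between `0` and `w₀`. -/
theorem Approx.conv {v w : ℕ → ℝ} {w₀ q c : ℝ} {K L : ℕ} {I J : Finset ℕ} {F G : ℕ → ℝ}
    (hw₀ : 0 < w₀) (hq : 1 < q) (hL : 2 ≤ q ^ L) (hc : 1 ≤ c) (hIJ : Disjoint I J)
    (hw : ∀ i ∈ I ∪ J, w₀ ≤ w i)
    (hF : Approx v w (grid w₀ q) K I c F) (hG : Approx v w (grid w₀ q) K J 1 G) :
    Approx v w (grid w₀ q) K (I ∪ J) (q * c)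
      fun k => conv (shift q K) F G k (L + 1) where
  mono := conv_monotoneOn hF.mono hG.mono _
  sound k hk := by
    have key : ∀ a ≤ K, ∀ b ≤ K, grid w₀ q a + grid w₀ q b ≤ grid w₀ q k →
        ∃ S ⊆ I ∪ J, ∑ i ∈ S, w i ≤ grid w₀ q k ∧ F a + G b ≤ ∑ i ∈ S, v i := by
      intro a ha b hb hab
      obtain ⟨S, hS, hS₁, hS₂⟩ := hF.sound a ha
      obtain ⟨T, hT, hT₁, hT₂⟩ := hG.sound b hb
      have hST : Disjoint S T := Finset.disjoint_of_subset_left hS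
        (Finset.disjoint_of_subset_right hT hIJ)
      refine ⟨S ∪ T, Finset.union_subset_union hS hT, ?_, ?_⟩ <;>
        rw [Finset.sum_union hST] <;> linarith
    refine conv_induction (fun z => ∃ S ⊆ I ∪ J, ∑ i ∈ S, w i ≤ grid w₀ q k ∧ z ≤ ∑ i ∈ S, v i)
      ?_ ?_ ?_
    · exact ⟨∅, Finset.empty_subset _, by simpa using grid_nonneg hw₀ hq k, by simp⟩
    · intro d _
      exact key _ (by omega) _ (by omega) (grid_add_shift_le hw₀ hq hk d)
    · intro d _
      exact key _ (by omega) _ (by omega) (by linarith [grid_add_shift_le hw₀ hq hk d])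
  complete k hk S hS hSk := by
    have hwt : ∀ T ⊆ I ∪ J, c * ∑ i ∈ T, w i = 0 ∨ w₀ ≤ c * ∑ i ∈ T, w i := by
      intro T hT
      rcases T.eq_empty_or_nonempty with rfl | ⟨i, hi⟩
      · simp
      · right
        have h₁ : w i ≤ ∑ i ∈ T, w i := Finset.single_le_sum
          (fun j hj => hw₀.le.trans (hw j (hT hj))) hi
        have h₂ := hw i (hT hi)
        nlinarith
    have hwt' : ∀ T ⊆ I ∪ J, 0 ≤ c * ∑ i ∈ T, w i := fun T hT => by
      rcases hwt T hT with h | h <;> linarith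
    have hI : S ∩ I ⊆ I ∪ J := Finset.inter_subset_left.trans hS
    have hJ : S \ I ⊆ I ∪ J := Finset.sdiff_subset.trans hS
    have hJ' : S \ I ⊆ J := by
      intro i hi
      rw [Finset.mem_sdiff] at hi
      exact (Finset.mem_union.1 (hS hi.1)).resolve_left hi.2
    have hsum (f : ℕ → ℝ) : ∑ i ∈ S, f i = ∑ i ∈ S ∩ I, f i + ∑ i ∈ S \ I, f i :=
      (Finset.sum_inter_add_sum_sdiff S I f).symm
    rw [hsum w] at hSk
    have hkK : grid w₀ q k ≤ grid w₀ q K := (grid_strictMono hw₀ hq).monotone hk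
    obtain ⟨a, ha, ha₁, ha₂⟩ := exists_grid (K := K) hw₀ hq (hwt _ hI)
      (by nlinarith [hwt' _ hI, hwt' _ hJ])
    obtain ⟨b, hb, hb₁, hb₂⟩ := exists_grid (K := K) hw₀ hq (hwt _ hJ)
      (by nlinarith [hwt' _ hI, hwt' _ hJ])
    have hab : grid w₀ q a + grid w₀ q b ≤ grid w₀ q k := by linarith
    have hFa := hF.complete a ha _ Finset.inter_subset_right ha₁
    have hGb := hG.complete b hb _ hJ' (by
      have : 0 ≤ ∑ i ∈ S \ I, w i :=
        Finset.sum_nonneg fun j hj => hw₀.le.trans (hw j (hJ hj))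
      nlinarith)
    rw [hsum v]
    refine (add_le_add hFa hGb).trans ?_
    rcases le_total a b with h | h
    · obtain ⟨d, hd, h₁, h₂⟩ := exists_shift hw₀ hq hL h hab
      refine le_trans (add_le_add (hF.mono ?_ ?_ h₂) (hG.mono ?_ ?_ h₁))
        (le_conv (Nat.lt_succ_of_le hd)).2 <;> simp only [Set.mem_Iic] <;> omega
    · obtain ⟨d, hd, h₁, h₂⟩ := exists_shift (K := K) (k := k) hw₀ hq hL h (by linarith)
      refine le_trans (add_le_add (hF.mono ?_ ?_ h₁) (hG.mono ?_ ?_ h₂))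
        (le_conv (Nat.lt_succ_of_le hd)).1 <;> simp only [Set.mem_Iic] <;> omega

/-- Among items sorted by decreasing value, a prefix `[a, p)` is the most valuable selection of its
size. -/
theorem sum_le_sum_prefix {v : ℕ → ℝ} {a p b : ℕ} (hap : a ≤ p)
    (hv : ∀ i, 0 ≤ v i) (hsort : ∀ x y, a ≤ x → x < y → y < b → v y ≤ v x)
    {T : Finset ℕ} (hT : T ⊆ Finset.Ico a b) (hcard : b ≤ p ∨ T.card ≤ p - a) :
    ∑ i ∈ T, v i ≤ ∑ i ∈ Finset.Ico a p, v i := by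
  rcases le_or_gt b p with hbp | hpb
  · exact Finset.sum_le_sum_of_subset_of_nonneg
      (hT.trans (Finset.Ico_subset_Ico_right hbp)) fun i _ _ => hv i
  have hcard := hcard.resolve_left (by omega)
  have h₁ := Finset.sum_inter_add_sum_sdiff T (Finset.Ico a p) v
  have h₂ := Finset.sum_inter_add_sum_sdiff (Finset.Ico a p) T v
  have h₃ : ∑ i ∈ T \ Finset.Ico a p, v i ≤ (T \ Finset.Ico a p).card • v p := by
    refine Finset.sum_le_card_nsmul _ _ _ fun i hi => ?_
    have := Finset.mem_Ico.1 (hT (Finset.mem_sdiff.1 hi).1)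
    have h' := (Finset.mem_sdiff.1 hi).2
    rw [Finset.mem_Ico] at h'
    rcases eq_or_lt_of_le (show p ≤ i by omega) with rfl | h
    · exact le_rfl
    · exact hsort p i hap h this.2
  have h₄ : (Finset.Ico a p \ T).card • v p ≤ ∑ i ∈ Finset.Ico a p \ T, v i := by
    refine Finset.card_nsmul_le_sum _ _ _ fun i hi => ?_
    have := Finset.mem_Ico.1 (Finset.mem_sdiff.1 hi).1
    exact hsort i p this.1 this.2 hpb
  have h₅ : (T \ Finset.Ico a p).card ≤ (Finset.Ico a p \ T).card :=
    (Finset.card_sdiff_le_card_sdiff_iff).2 (by simpa using hcard)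
  have h₆ := nsmul_le_nsmul_left (hv p) h₅
  rw [Finset.inter_comm] at h₂
  linarith

/-- The value table of one class of items of equal weight `wj`: if at every grid point the number of
items taken is maximal, then the table is exact. -/
theorem approx_class {v w Y : ℕ → ℝ} {K a b : ℕ} {wj : ℝ} {G : ℕ → ℝ} (hwj : 0 < wj)
    (hv : ∀ i, 0 ≤ v i) (hw : ∀ i ∈ Finset.Ico a b, w i = wj) (hY : Monotone Y)
    (hsort : ∀ x y, a ≤ x → x < y → y < b → v y ≤ v x)
    (hG : ∀ k ≤ K, ∃ p, a ≤ p ∧ p ≤ b ∧ G k = ∑ i ∈ Finset.Ico a p, v i ∧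
      ((p - a : ℕ) : ℝ) * wj ≤ Y k ∧ (p < b → Y k < ((p - a : ℕ) : ℝ) * wj + wj)) :
    Approx v w Y K (Finset.Ico a b) 1 G := by
  have hwt : ∀ T ⊆ Finset.Ico a b, ∑ i ∈ T, w i = T.card * wj := fun T hT => by
    rw [Finset.sum_congr rfl fun i hi => hw i (hT hi), Finset.sum_const, nsmul_eq_mul]
  have sound : ∀ k ≤ K, ∃ S ⊆ Finset.Ico a b, ∑ i ∈ S, w i ≤ Y k ∧ G k ≤ ∑ i ∈ S, v i := by
    intro k hk
    obtain ⟨p, hap, hpb, hGk, hp, -⟩ := hG k hk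
    refine ⟨Finset.Ico a p, Finset.Ico_subset_Ico_right hpb, ?_, hGk.le⟩
    rw [hwt _ (Finset.Ico_subset_Ico_right hpb), Nat.card_Ico]
    exact hp
  have complete : ∀ k ≤ K, ∀ S ⊆ Finset.Ico a b, 1 * ∑ i ∈ S, w i ≤ Y k →
      ∑ i ∈ S, v i ≤ G k := by
    intro k hk S hS hSk
    obtain ⟨p, hap, hpb, hGk, -, hp⟩ := hG k hk
    rw [hGk]
    refine sum_le_sum_prefix hap hv hsort hS ?_
    rcases le_or_gt b p with h | h
    · exact .inl h
    · right
      rw [one_mul, hwt S hS] at hSk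
      have : (S.card : ℝ) * wj < ((p - a + 1 : ℕ) : ℝ) * wj := by
        push_cast
        linarith [hp h]
      have := lt_of_mul_lt_mul_right this hwj.le
      exact Nat.lt_succ_iff.1 (by exact_mod_cast this)
  refine ⟨sound, complete, fun k hk k' hk' hkk => ?_⟩
  obtain ⟨S, hS, hS₁, hS₂⟩ := sound k hk
  exact hS₂.trans (complete k' hk' S hS (by linarith [hY hkk]))

end Knapsack

namespace RealRAM

open Knapsack

/-! ### The knapsack program -/

/-- Counts the distinct weights; equal weights are adjacent in the sorted order. -/
def countWeights : Prog :=
  .seq (.setIndex 1 (.const 1)) <|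
  .seq (.setIndex 8 (.const 1)) <|
  .loop (.neg (.ile (.var 0) (.var 1))) <|
  .seq (.branch (.rle (.get 1 (.get 0 (.var 1))) (.get 1 (.get 0 (.sub (.var 1) (.const 1)))))
    .skip (.setIndex 8 (.add (.var 8) (.const 1)))) <|
  .setIndex 1 (.add (.var 1) (.const 1))

/-- Tabulates the powers of `q = 1 + ε / m` and the grid, up to the first grid point `K ≥ 1` that is
at least `8` times an upper bound of the total weight. -/
def makeGrid : Prog :=
  .seq (.setReal 1 (.add (.ofIndex (.const 1)) (.div (.var 0) (.ofIndex (.var 8))))) <|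
  .seq (.putReal 2 (.const 0) (.ofIndex (.const 1))) <|
  .seq (.putReal 2 (.const 1) (.var 1)) <|
  .seq (.putReal 3 (.const 0) (.ofIndex (.const 0))) <|
  .seq (.putReal 3 (.const 1) (.get 1 (.get 0 (.const 0)))) <|
  .seq (.setIndex 9 (.const 1)) <|
  .loop (.neg (.rle (.mul (.mul (.ofIndex (.const 8)) (.ofIndex (.var 0)))
      (.get 1 (.get 0 (.sub (.var 0) (.const 1))))) (.get 3 (.var 9)))) <|
  .seq (.putReal 2 (.add (.var 9) (.const 1)) (.mul (.get 2 (.var 9)) (.var 1))) <|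
  .seq (.putReal 3 (.add (.var 9) (.const 1)) (.mul (.get 3 (.var 9)) (.var 1))) <|
  .setIndex 9 (.add (.var 9) (.const 1))

/-- Finds the least `L` with `2 ≤ q ^ L`. -/
def findHalf : Prog :=
  .seq (.setIndex 10 (.const 0)) <|
  .loop (.neg (.rle (.ofIndex (.const 2)) (.get 2 (.var 10)))) <|
  .setIndex 10 (.add (.var 10) (.const 1))

/-- Searches for `i = shift q K d`. -/
def findShift : Prog :=
  .loop (.conj (.neg (.ile (.var 9) (.var 1)))
    (.neg (.rle (.add (.div (.ofIndex (.const 1)) (.get 2 (.var 1)))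
      (.div (.ofIndex (.const 1)) (.get 2 (.var 12)))) (.ofIndex (.const 1))))) <|
  .setIndex 1 (.add (.var 1) (.const 1))

/-- Tabulates `shift q K d` for `d ≤ L`. -/
def makeShift : Prog :=
  .seq (.setIndex 12 (.const 0)) <|
  .seq (.setIndex 1 (.const 0)) <|
  .loop (.neg (.ile (.add (.var 10) (.const 1)) (.var 12))) <|
  .seq findShift <|
  .seq (.putIndex 2 (.var 12) (.var 1)) <|
  .seq (.setIndex 1 (.const 0)) <|
  .setIndex 12 (.add (.var 12) (.const 1))

/-- Takes the next item of the class if the budget `Y k` allows it, and otherwise records the value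
of the items taken as `G k` and goes on to the next grid point. -/
def fillStep : Prog :=
  .branch (.conj (.neg (.ile (.var 0) (.var 11)))
      (.conj (.rle (.get 1 (.get 0 (.var 11))) (.var 2))
        (.rle (.add (.var 4) (.var 2)) (.get 3 (.var 3)))))
    (.seq (.setReal 3 (.add (.var 3) (.get 0 (.get 0 (.var 11))))) <|
      .seq (.setReal 4 (.add (.var 4) (.var 2))) <|
      .setIndex 11 (.add (.var 11) (.const 1)))
    (.seq (.putReal 5 (.var 3) (.var 3)) <|
      .setIndex 3 (.add (.var 3) (.const 1)))

/-- Tabulates in `G` the optimal values for the items of one weight, those from position `p` on; as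
the budget `Y k` grows, further items are taken in order. -/
def fillTable : Prog :=
  .seq (.setReal 2 (.get 1 (.get 0 (.var 11)))) <|
  .seq (.setIndex 3 (.const 0)) <|
  .seq (.setReal 3 (.ofIndex (.const 0))) <|
  .seq (.setReal 4 (.ofIndex (.const 0))) <|
  .loop (.neg (.ile (.add (.var 9) (.const 1)) (.var 3))) fillStep

/-- One step of the recursion that defines `conv`, with the value in `best`. -/
def convStep : Prog :=
  .seq (.branch (.rle (.add (.get 4 (.sub (.var 3) (.var 12)))
      (.get 5 (.sub (.var 3) (.get 2 (.var 12))))) (.var 5)) .skip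
    (.setReal 5 (.add (.get 4 (.sub (.var 3) (.var 12)))
      (.get 5 (.sub (.var 3) (.get 2 (.var 12))))))) <|
  .seq (.branch (.rle (.add (.get 4 (.sub (.var 3) (.get 2 (.var 12))))
      (.get 5 (.sub (.var 3) (.var 12)))) (.var 5)) .skip
    (.setReal 5 (.add (.get 4 (.sub (.var 3) (.get 2 (.var 12))))
      (.get 5 (.sub (.var 3) (.var 12)))))) <|
  .setIndex 12 (.add (.var 12) (.const 1))

/-- Computes `best = conv st F G k (L + 1)`. -/
def convLoop : Prog := .loop (.neg (.ile (.add (.var 10) (.const 1)) (.var 12))) convStep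

/-- Replaces `F` by its convolution with `G`, which is collected in `H`, as all values of `F` are
needed until the end. -/
def convolve : Prog :=
  .seq (.setIndex 3 (.const 0)) <|
  .seq (.setIndex 12 (.const 0)) <|
  .seq (.setReal 5 (.ofIndex (.const 0))) <|
  .seq (.loop (.neg (.ile (.add (.var 9) (.const 1)) (.var 3))) <|
    .seq convLoop <|
    .seq (.putReal 6 (.var 3) (.var 5)) <|
    .seq (.setIndex 12 (.const 0)) <|
    .seq (.setReal 5 (.ofIndex (.const 0))) <|
    .setIndex 3 (.add (.var 3) (.const 1))) <|
  .seq (.setIndex 3 (.const 0)) <|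
  .loop (.neg (.ile (.add (.var 9) (.const 1)) (.var 3))) <|
  .seq (.putReal 4 (.var 3) (.get 6 (.var 3))) <|
  .setIndex 3 (.add (.var 3) (.const 1))

/-- Treats the weight classes one after the other. -/
def processClasses : Prog :=
  .seq (.setIndex 11 (.const 0)) <|
  .loop (.neg (.ile (.var 0) (.var 11))) <| .seq fillTable convolve

/-- Writes the breakpoints `(Y k, F k)` for `k ≤ K` to the output. -/
def emitTable : Prog :=
  .seq (.setIndex 3 (.const 0)) <|
  .loop (.neg (.ile (.add (.var 9) (.const 1)) (.var 3))) <|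
  .seq (.emit (.get 3 (.var 3)) (.get 4 (.var 3))) <|
  .setIndex 3 (.add (.var 3) (.const 1))

/-- The whole algorithm. -/
def knapsackProg : Prog :=
  .seq sortItems <| .seq countWeights <| .seq makeGrid <| .seq findHalf <| .seq makeShift <|
  .seq processClasses emitTable

theorem wp_countWeights (s : Mem) (hn : 0 < s.n)
    (hs : ∀ x y, x < y → y < s.n → s.W (s.A x) ≤ s.W (s.A y)) :
    wp countWeights s fun t s' => t ≤ s.n * 40 + 10 ∧ s' = { s with
      i := s.n, m := ((Finset.range s.n).image fun i => s.W (s.A i)).card } := by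
  have h := wp_for (b := .neg (.ile (.var 0) (.var 1)))
    (p := .seq (.branch (.rle (.get 1 (.get 0 (.var 1)))
      (.get 1 (.get 0 (.sub (.var 1) (.const 1)))))
      .skip (.setIndex 8 (.add (.var 8) (.const 1)))) (.setIndex 1 (.add (.var 1) (.const 1))))
    (fun x => { s with i := x, m := ((Finset.range x).image fun i => s.W (s.A i)).card })
    (lo := 1) (hi := s.n) 30 hn (by simp) (by simp) ?_
  · simp only [Finset.range_one, Finset.image_singleton, Finset.card_singleton] at h
    simp only [countWeights, wp, IExp.cost, Mem.setI, IExp.eval]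
    refine ⟨by norm_num, by norm_num, wp_mono h ?_⟩
    rintro t _ ⟨ht, rfl⟩
    simp only [BExp.cost, IExp.cost] at ht
    exact ⟨by omega, rfl⟩
  · intro x hx hxn
    have : ((Finset.range (x + 1)).image fun i => s.W (s.A i)).card =
        ((Finset.range x).image fun i => s.W (s.A i)).card +
          if s.W (s.A x) ≤ s.W (s.A (x - 1)) then 0 else 1 := by
      rw [Finset.range_add_one, Finset.image_insert]
      split_ifs with h
      · rw [Finset.insert_eq_of_mem, add_zero]
        rw [Finset.mem_image]
        exact ⟨x - 1, by simp; omega, le_antisymm (hs _ _ (by omega) hxn) h⟩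
      · rw [Finset.card_insert_of_notMem]
        rw [Finset.mem_image]
        rintro ⟨y, hy, hyx⟩
        rw [Finset.mem_range] at hy
        refine h (hyx.ge.trans ?_)
        rcases eq_or_lt_of_le (show y ≤ x - 1 by omega) with rfl | hlt
        · exact le_rfl
        · exact hs _ _ hlt (by omega)
    simp only [this]
    simp only [wp]
    constructor <;> intro hb <;> simp at hb ⊢ <;> simp [hb]

theorem wp_makeGrid (s : Mem) (hm : 0 < s.m) (he : 0 < s.eps) (hw : 0 < s.W (s.A 0)) :
    wp makeGrid s fun t s' => ∃ q K pw Y, s' = { s with q := q, K := K, pw := pw, Y := Y } ∧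
      t ≤ K * 60 + 50 ∧ q = 1 + s.eps / s.m ∧ 0 < K ∧ (∀ k ≤ K, pw k = q ^ k) ∧
      (∀ k ≤ K, Y k = grid (s.W (s.A 0)) q k) ∧
      8 * s.n * s.W (s.A (s.n - 1)) ≤ grid (s.W (s.A 0)) q K ∧
      (1 < K → grid (s.W (s.A 0)) q (K - 1) < 8 * s.n * s.W (s.A (s.n - 1))) := by
  classical
  obtain ⟨q, hq⟩ : ∃ q, q = 1 + s.eps / s.m := ⟨_, rfl⟩
  have hq1 : 1 < q := by
    have : 0 < s.eps / s.m := by positivity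
    linarith
  have hex : ∃ k, 0 < k ∧ 8 * s.n * s.W (s.A (s.n - 1)) ≤ grid (s.W (s.A 0)) q k := by
    obtain ⟨k, hk⟩ := pow_unbounded_of_one_lt (8 * s.n * s.W (s.A (s.n - 1)) / s.W (s.A 0)) hq1
    refine ⟨k + 1, by simp, ?_⟩
    rw [div_lt_iff₀ hw] at hk
    rw [grid_succ]
    linarith
  obtain ⟨K, hK⟩ : ∃ K, K = Nat.find hex := ⟨_, rfl⟩
  have hK₁ := Nat.find_spec hex
  rw [← hK] at hK₁
  have hK₂ : ∀ k, 0 < k → k < K → grid (s.W (s.A 0)) q k < 8 * s.n * s.W (s.A (s.n - 1)) := by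
    intro k hk hkK
    have := Nat.find_min hex (hK ▸ hkK)
    rw [not_and, not_le] at this
    exact this hk
  have h := wp_for (b := .neg (.rle (.mul (.mul (.ofIndex (.const 8)) (.ofIndex (.var 0)))
      (.get 1 (.get 0 (.sub (.var 0) (.const 1))))) (.get 3 (.var 9))))
    (p := .seq (.putReal 2 (.add (.var 9) (.const 1)) (.mul (.get 2 (.var 9)) (.var 1))) <|
      .seq (.putReal 3 (.add (.var 9) (.const 1)) (.mul (.get 3 (.var 9)) (.var 1))) <|
      .setIndex 9 (.add (.var 9) (.const 1)))
    (fun x => { s with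
      q := q, K := x, pw := fun k => if k ≤ x then q ^ k else s.pw k,
      Y := fun k => if k ≤ x then grid (s.W (s.A 0)) q k else s.Y k })
    (lo := 1) (hi := K) 40 hK₁.1 ?_ ?_ ?_
  · have hpre : (fun k => if k ≤ 1 then q ^ k else s.pw k) =
        Function.update (Function.update s.pw 0 1) 1 q := by
      funext k
      rcases k with _ | _ | k <;> simp
    have hpre' : (fun k => if k ≤ 1 then grid (s.W (s.A 0)) q k else s.Y k) =
        Function.update (Function.update s.Y 0 0) 1 (s.W (s.A 0)) := by
      funext k
      rcases k with _ | _ | k <;> simp [grid]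
    simp only [hpre, hpre'] at h
    unfold makeGrid
    refine wp_seq (Q := fun t s' => t ≤ 10 ∧ s' = { s with q := q }) (by simp [hq]) ?_
    rintro t₀ _ ⟨ht₀, rfl⟩
    simp only [wp, IExp.cost, RExp.cost, Mem.setI, Mem.setRA, IExp.eval, RExp.eval,
      Mem.store_rvar, Mem.store_rarr, Mem.store_iarr, Mem.getR, Mem.getRA, Mem.getIA,
      Nat.cast_one, Nat.cast_zero]
    refine ⟨by norm_num, by norm_num, by norm_num, by norm_num, by norm_num, wp_mono h ?_⟩
    rintro t _ ⟨ht, rfl⟩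
    simp only [BExp.cost, IExp.cost, RExp.cost] at ht
    refine ⟨q, K, _, _, rfl, by omega, hq, hK₁.1, fun k hk => by simp [hk], fun k hk => by simp [hk],
      hK₁.2, fun h => hK₂ _ (by omega) (by omega)⟩
  · intro x hx hxK
    simpa using hK₂ x hx hxK
  · simpa using hK₁.2
  · intro x hx hxK
    simp
    constructor
    · funext k
      rw [Function.update_apply]
      rcases lt_trichotomy k (x + 1) with h | h | h
      · simp [h.ne, show k ≤ x by omega, show k ≤ x + 1 by omega]
      · subst h; simp [pow_succ]
      · simp [h.ne', show ¬ k ≤ x by omega, show ¬ k ≤ x + 1 by omega]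
    · obtain ⟨x, rfl⟩ : ∃ y, x = y + 1 := ⟨x - 1, by omega⟩
      funext k
      rw [Function.update_apply]
      rcases lt_trichotomy k (x + 1 + 1) with h | h | h
      · simp [h.ne, show k ≤ x + 1 by omega, show k ≤ x + 1 + 1 by omega]
      · subst h; simp [pow_succ, mul_assoc]
      · simp [h.ne', show ¬ k ≤ x + 1 by omega, show ¬ k ≤ x + 1 + 1 by omega]

theorem wp_findHalf (s : Mem) {q : ℝ} (hpw : ∀ k ≤ s.K, s.pw k = q ^ k) (hK : 2 ≤ q ^ s.K) :
    wp findHalf s fun t s' => ∃ L, s' = { s with L := L } ∧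
      t ≤ L * 20 + 10 ∧ L ≤ s.K ∧ 2 ≤ q ^ L ∧ (0 < L → q ^ (L - 1) < 2) := by
  classical
  have hex : ∃ k, 2 ≤ q ^ k := ⟨_, hK⟩
  obtain ⟨L, hL⟩ : ∃ L, L = Nat.find hex := ⟨_, rfl⟩
  have hLK : L ≤ s.K := hL ▸ Nat.find_min' hex hK
  have hL₁ : 2 ≤ q ^ L := hL ▸ Nat.find_spec hex
  have hL₂ : ∀ k < L, q ^ k < 2 := fun k hk => not_le.1 (Nat.find_min hex (hL ▸ hk))
  simp only [findHalf, wp, IExp.cost, Mem.setI, IExp.eval]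
  refine ⟨by norm_num, wp_mono (wp_for (fun x => { s with L := x }) (lo := 0) (hi := L) 4
    (Nat.zero_le _) ?_ ?_ ?_) ?_⟩
  · intro x _ hx
    simpa [hpw x (by omega)] using hL₂ x hx
  · simpa [hpw L hLK] using hL₁
  · intro x _ _
    simp
  · rintro t _ ⟨ht, rfl⟩
    simp only [BExp.cost, IExp.cost, RExp.cost] at ht
    exact ⟨L, rfl, by omega, hLK, hL₁, fun h => hL₂ _ (by omega)⟩

theorem wp_makeShift (s : Mem) {q : ℝ} (hpw : ∀ k ≤ s.K, s.pw k = q ^ k) (hL : s.L ≤ s.K) :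
    wp makeShift s fun t s' => ∃ i d st, s' = { s with i := i, d := d, st := st } ∧
      t ≤ (s.L + 1) * (s.K * 30 + 50) + 20 ∧ ∀ d ≤ s.L, st d = shift q s.K d := by
  simp only [makeShift, wp, IExp.cost, Mem.setI, IExp.eval]
  refine ⟨by norm_num, by norm_num, wp_mono (wp_for (fun x => { s with
    i := 0, d := x, st := fun d => if d < x then shift q s.K d else s.st d })
    (lo := 0) (hi := s.L + 1) (s.K * 30 + 40) (Nat.zero_le _) (by simp) (by simp) ?_) ?_⟩
  · intro x _ hx
    have hxK : s.pw x = q ^ x := hpw x (by omega)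
    have hle : shift q s.K x ≤ s.K := shift_le (.inl le_rfl)
    refine wp_seq (wp_for (fun y => { s with
      i := y, d := x, st := fun d => if d < x then shift q s.K d else s.st d })
      (lo := 0) (hi := shift q s.K x) 4 (Nat.zero_le _) ?_ ?_ ?_) ?_
    · intro y _ hy
      simp only [BExp.Holds, IExp.eval, RExp.eval, Mem.store_ivar, Mem.store_rarr, Mem.getI,
        Mem.getRA, hxK, hpw y (by omega), Nat.cast_one]
      have : ¬ _ := fun h => absurd (shift_le (q := q) (K := s.K) (d := x) h) (not_le.2 hy)
      push Not at this ⊢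
      exact this
    · simp only [BExp.Holds, IExp.eval, RExp.eval, Mem.store_ivar, Mem.store_rarr, Mem.getI,
        Mem.getRA, hxK, hpw _ hle, Nat.cast_one]
      have := shift_spec q s.K x
      tauto
    · intro y _ _
      simp
    · rintro t _ ⟨ht, rfl⟩
      simp only [BExp.cost, IExp.cost, RExp.cost] at ht
      refine wp_mono (Q := fun t s' => t ≤ 12 ∧ s' = { s with
        i := 0, d := x + 1, st := fun d => if d < x + 1 then shift q s.K d else s.st d }) ?_ ?_
      · simp
        funext d
        rw [Function.update_apply]
        grind
      · rintro t' _ ⟨ht', rfl⟩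
        exact ⟨by omega, rfl⟩
  · rintro t _ ⟨ht, rfl⟩
    simp only [BExp.cost, IExp.cost] at ht
    refine ⟨_, _, _, rfl, ?_, fun d hd => by simp [Nat.lt_succ_of_le hd]⟩
    rw [Nat.sub_zero, show s.K * 30 + 40 + (1 + (1 + 1 + 1) + 1 + 1) + 1 = s.K * 30 + 47 by ring]
      at ht
    nlinarith

end RealRAM

namespace RealRAM

open Knapsack

/-- Every iteration takes an item or completes a grid point, so the cost is linear in the number of
items of the class and in `K`. As the last grid point allows all items, the whole class is used
up. -/
theorem wp_fillTable (s : Mem) {Y : ℕ → ℝ} (hp : s.p < s.n) (hV : ∀ i, 0 ≤ s.V i)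
    (hW : 0 < s.W (s.A s.p)) (hY : Monotone Y) (hY₀ : 0 ≤ Y 0) (hsY : ∀ k ≤ s.K, s.Y k = Y k)
    (hs : ∀ x y, x < y → y < s.n → Precedes s.V s.W (s.A x) (s.A y))
    (hbig : s.n * s.W (s.A s.p) ≤ Y s.K) :
    wp fillTable s fun t s' => ∃ k p wj acc accw G,
      s' = { s with k := k, p := p, wj := wj, acc := acc, accw := accw, G := G } ∧
      t + 60 * s.p ≤ 60 * p + (s.K + 1) * 60 + 30 ∧ s.p < p ∧ p ≤ s.n ∧
      (∀ i, s.p ≤ i → i < p → s.W (s.A i) = s.W (s.A s.p)) ∧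
      (p < s.n → s.W (s.A s.p) < s.W (s.A p)) ∧
      Approx (fun i => s.V (s.A i)) (fun i => s.W (s.A i)) Y s.K (Finset.Ico s.p p) 1 G := by
  obtain ⟨wj, hwj⟩ : ∃ wj, wj = s.W (s.A s.p) := ⟨_, rfl⟩
  rw [← hwj] at hW hbig ⊢
  refine wp_seq (Q := fun t s' => t ≤ 4 ∧ s' = { s with wj := wj }) (by simp [hwj]) ?_
  rintro t₀ _ ⟨ht₀, rfl⟩
  refine wp_seq (Q := fun t s' => t ≤ 2 ∧ s' = { s with wj := wj, k := 0 }) (by simp) ?_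
  rintro t₁ _ ⟨ht₁, rfl⟩
  refine wp_seq (Q := fun t s' => t ≤ 3 ∧ s' = { s with wj := wj, k := 0, acc := 0 }) (by simp) ?_
  rintro t₂ _ ⟨ht₂, rfl⟩
  refine wp_seq (Q := fun t s' => t ≤ 3 ∧ s' =
    { s with wj := wj, k := 0, acc := 0, accw := 0 }) (by simp) ?_
  rintro t₃ _ ⟨ht₃, rfl⟩
  refine wp_mono (wp_while (fun s' => ∃ k p G, s' = { s with
      k := k, p := p, wj := wj, acc := ∑ i ∈ Finset.Ico s.p p, s.V (s.A i),
      accw := ((p - s.p : ℕ) : ℝ) * wj, G := G } ∧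
      s.p ≤ p ∧ p ≤ s.n ∧ k ≤ s.K + 1 ∧
      (∀ i, s.p ≤ i → i < p → s.W (s.A i) = wj) ∧
      (k ≤ s.K → ((p - s.p : ℕ) : ℝ) * wj ≤ Y k) ∧
      (∀ k' < k, ∃ r, s.p ≤ r ∧ r ≤ p ∧ G k' = ∑ i ∈ Finset.Ico s.p r, s.V (s.A i) ∧
        ((r - s.p : ℕ) : ℝ) * wj ≤ Y k' ∧
        (r < s.n → s.W (s.A r) ≤ wj → Y k' < ((r - s.p : ℕ) : ℝ) * wj + wj)) ∧
      (s.K < k → p < s.n → wj < s.W (s.A p)))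
    (fun s' => (s.n - s'.p) * 60 + (s.K + 1 - s'.k) * 60) ?_ _ ?_) ?_
  · rintro _ ⟨k, p, G, rfl, h₁, h₂, h₃, h₄, h₅, h₆, h₇⟩ hk
    simp at hk
    by_cases hb : p < s.n ∧ s.W (s.A p) ≤ wj ∧ ((p - s.p : ℕ) : ℝ) * wj + wj ≤ Y k
    · have hsub : p + 1 - s.p = p - s.p + 1 := by omega
      refine wp_mono (Q := fun t s' => t ≤ 40 ∧ s' = { s with
        k := k, p := p + 1, wj := wj, acc := ∑ i ∈ Finset.Ico s.p (p + 1), s.V (s.A i),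
        accw := ((p + 1 - s.p : ℕ) : ℝ) * wj, G := G }) ?_ ?_
      · rw [Finset.sum_Ico_succ_top h₁, hsub]
        simp [fillStep, hsY k (by omega), hb, add_mul]
      · rintro t _ ⟨ht, rfl⟩
        refine ⟨⟨k, p + 1, G, rfl, by omega, by omega, h₃, ?_, ?_, ?_, by omega⟩, ?_⟩
        · intro i hi hi'
          rcases Nat.lt_succ_iff_lt_or_eq.1 hi' with h | rfl
          · exact h₄ i hi h
          · refine le_antisymm hb.2.1 ?_
            rcases eq_or_lt_of_le h₁ with h | h
            · rw [hwj, h]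
            · exact hwj.le.trans (hs _ _ h hb.1).1
        · intro _
          rw [hsub]
          push_cast
          linarith [hb.2.2]
        · intro k' hk'
          obtain ⟨r, hr₁, hr₂, hr⟩ := h₆ k' hk'
          exact ⟨r, hr₁, by omega, hr⟩
        · simp only [BExp.cost, IExp.cost]
          omega
    · refine wp_mono (Q := fun t s' => t ≤ 40 ∧ s' = { s with
        k := k + 1, p := p, wj := wj, acc := ∑ i ∈ Finset.Ico s.p p, s.V (s.A i),
        accw := ((p - s.p : ℕ) : ℝ) * wj,
        G := Function.update G k (∑ i ∈ Finset.Ico s.p p, s.V (s.A i)) }) ?_ ?_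
      · have : ¬ BExp.Holds (Mem.store { s with
            k := k, p := p, wj := wj, acc := ∑ i ∈ Finset.Ico s.p p, s.V (s.A i),
            accw := ((p - s.p : ℕ) : ℝ) * wj, G := G })
            (.conj (.neg (.ile (.var 0) (.var 11)))
            (.conj (.rle (.get 1 (.get 0 (.var 11))) (.var 2))
            (.rle (.add (.var 4) (.var 2)) (.get 3 (.var 3))))) := by
          simpa [hsY k (by omega)] using hb
        unfold fillStep
        rw [wp]
        refine ⟨fun h => absurd h this, fun _ => ?_⟩
        simp
      · push Not at hb
        rintro t _ ⟨ht, rfl⟩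
        refine ⟨⟨k + 1, p, _, rfl, h₁, h₂, by omega, h₄, ?_, ?_, ?_⟩, ?_⟩
        · intro _
          exact (h₅ (by omega)).trans (hY k.le_succ)
        · intro k' hk'
          rcases Nat.lt_succ_iff_lt_or_eq.1 hk' with h | rfl
          · rw [Function.update_of_ne h.ne]
            exact h₆ k' h
          · rw [Function.update_self]
            exact ⟨p, h₁, le_rfl, rfl, h₅ (by omega), hb⟩
        · -- at the last grid point, no item of the class can have been left out for lack of budget
          intro hk' hpn
          by_contra hle
          obtain rfl : k = s.K := by omega
          have h := hb hpn (not_lt.1 hle)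
          have : ((p - s.p : ℕ) : ℝ) + 1 ≤ s.n := by
            exact_mod_cast (by omega : p - s.p + 1 ≤ s.n)
          nlinarith
        · simp only [BExp.cost, IExp.cost]
          omega
  · refine ⟨0, s.p, s.G, by simp, le_rfl, hp.le, by omega, fun i _ _ => by omega, ?_,
      fun k hk => by omega, fun h => by omega⟩
    simpa using hY₀
  · rintro t _ ⟨ht, ⟨k, p, G, rfl, h₁, h₂, h₃, h₄, h₅, h₆, h₇⟩, hk⟩
    simp at hk ht
    have hlt : p < s.n → wj < s.W (s.A p) := h₇ (by omega)
    have hpp : s.p < p := by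
      rcases eq_or_lt_of_le h₁ with h | h
      · rw [← h] at hlt
        exact absurd (hlt hp) (by rw [hwj]; exact lt_irrefl _)
      · exact h
    refine ⟨k, p, wj, _, _, G, rfl, by omega, hpp, h₂, h₄, hlt, ?_⟩
    refine approx_class hW (fun i => hV _) (fun i hi => ?_) hY (fun x y hx hxy hy => ?_)
      fun k' hk' => ?_
    · rw [Finset.mem_Ico] at hi
      exact h₄ i hi.1 hi.2
    · have h := (hs x y hxy (by omega)).2
      by_contra hv
      exact h ⟨by rw [h₄ x hx (by omega), h₄ y (by omega) hy], hv⟩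
    · obtain ⟨r, hr₁, hr₂, hr₃, hr₄, hr₅⟩ := h₆ k' (by omega)
      exact ⟨r, hr₁, hr₂, hr₃, hr₄, fun h => hr₅ (by omega) (h₄ r hr₁ h).le⟩

theorem wp_convolve (s : Mem) :
    wp convolve s fun t s' => ∃ k d best F H,
      s' = { s with k := k, d := d, best := best, F := F, H := H } ∧
      t ≤ (s.K + 1) * ((s.L + 1) * 100 + 60) + 40 ∧
      ∀ k ≤ s.K, F k = conv s.st s.F s.G k (s.L + 1) := by
  simp only [convolve, wp, IExp.cost, RExp.cost, Mem.setI, Mem.setR, IExp.eval, RExp.eval,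
    Nat.cast_zero]
  refine ⟨by norm_num, by norm_num, by norm_num, wp_mono (wp_for (fun x => { s with
    k := x, d := 0, best := 0,
    H := fun k => if k < x then conv s.st s.F s.G k (s.L + 1) else s.H k })
    (lo := 0) (hi := s.K + 1) ((s.L + 1) * 100 + 30) (Nat.zero_le _) (by simp) (by simp) ?_) ?_⟩
  · intro x _ hx
    refine wp_seq (wp_for (fun y => { s with
      k := x, d := y, best := conv s.st s.F s.G x y,
      H := fun k => if k < x then conv s.st s.F s.G k (s.L + 1) else s.H k })
      (lo := 0) (hi := s.L + 1) 90 (Nat.zero_le _) (by simp) (by simp) ?_) ?_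
    · intro y _ hy
      refine wp_seq (Q := fun t s' => t ≤ 42 ∧ s' = { s with
        k := x, d := y, best := max (conv s.st s.F s.G x y) (s.F (x - y) + s.G (x - s.st y)),
        H := fun k => if k < x then conv s.st s.F s.G k (s.L + 1) else s.H k }) ?_ ?_
      · simp only [wp]
        constructor <;> intro hb <;> simp at hb ⊢
        · exact hb
        · exact hb.le
      rintro t₁ _ ⟨ht₁, rfl⟩
      refine wp_seq (Q := fun t s' => t ≤ 42 ∧ s' = { s with
        k := x, d := y, best := conv s.st s.F s.G x (y + 1),
        H := fun k => if k < x then conv s.st s.F s.G k (s.L + 1) else s.H k }) ?_ ?_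
      · rw [conv]
        generalize max (conv s.st s.F s.G x y) (s.F (x - y) + s.G (x - s.st y)) = z
        simp only [wp]
        constructor <;> intro hb <;> simp at hb ⊢
        · exact hb
        · exact hb.le
      rintro t₂ _ ⟨ht₂, rfl⟩
      simp
      omega
    · rintro t₁ _ ⟨ht₁, rfl⟩
      simp only [BExp.cost, IExp.cost] at ht₁
      refine wp_mono (Q := fun t s' => t ≤ 20 ∧ s' = { s with
        k := x + 1, d := 0, best := 0,
        H := fun k => if k < x + 1 then conv s.st s.F s.G k (s.L + 1) else s.H k }) ?_ ?_
      · simp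
        funext k
        rw [Function.update_apply]
        grind
      · rintro t₂ _ ⟨ht₂, rfl⟩
        exact ⟨by omega, rfl⟩
  · rintro t₁ _ ⟨ht₁, rfl⟩
    refine ⟨by norm_num, wp_mono (wp_for (fun x => { s with
      k := x, d := 0, best := 0,
      F := fun k => if k < x then conv s.st s.F s.G k (s.L + 1) else s.F k,
      H := fun k => if k < s.K + 1 then conv s.st s.F s.G k (s.L + 1) else s.H k })
      (lo := 0) (hi := s.K + 1) 12 (Nat.zero_le _) (by simp) (by simp) ?_) ?_⟩
    · intro x _ hx
      simp
      funext k
      rw [Function.update_apply]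
      grind
    · rintro t₂ _ ⟨ht₂, rfl⟩
      simp only [BExp.cost, IExp.cost, Nat.sub_zero] at ht₁ ht₂
      refine ⟨_, _, _, _, _, rfl, ?_, fun k hk => by simp [Nat.lt_succ_of_le hk]⟩
      nlinarith

/-- The number of distinct weights among the first `p` items is the number of classes treated so
far; it is the exponent of the accuracy. -/
theorem wp_processClasses (s : Mem) {w₀ q : ℝ} (hw₀ : 0 < w₀) (hq : 1 < q)
    (hV : ∀ i, 0 ≤ s.V i) (hW : ∀ i < s.n, w₀ ≤ s.W (s.A i))
    (hs : ∀ x y, x < y → y < s.n → Precedes s.V s.W (s.A x) (s.A y))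
    (hY : ∀ k ≤ s.K, s.Y k = grid w₀ q k) (hst : ∀ d ≤ s.L, s.st d = shift q s.K d)
    (hL : 2 ≤ q ^ s.L) (hF : ∀ k, s.F k = 0)
    (hbig : ∀ i < s.n, s.n * s.W (s.A i) ≤ grid w₀ q s.K)
    (hm : s.m = ((Finset.range s.n).image fun i => s.W (s.A i)).card) :
    wp processClasses s fun t s' => ∃ k p d wj acc accw best F G H,
      s' = { s with
        k := k, p := p, d := d, wj := wj, acc := acc, accw := accw, best := best,
        F := F, G := G, H := H } ∧
      t ≤ s.m * ((s.K + 1) * (s.L + 1) * 350) + s.n * 60 + 10 ∧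
      Approx (fun i => s.V (s.A i)) (fun i => s.W (s.A i)) (grid w₀ q) s.K (Finset.range s.n)
        (q ^ s.m) F := by
  obtain ⟨cnt, hcnt⟩ : ∃ cnt : ℕ → ℕ,
    cnt = fun p => ((Finset.range p).image fun i => s.W (s.A i)).card := ⟨_, rfl⟩
  simp only [processClasses, wp, IExp.cost, Mem.setI, IExp.eval]
  refine ⟨by norm_num, wp_mono (wp_while (fun s' => ∃ k p d wj acc accw best F G H,
      s' = { s with
        k := k, p := p, d := d, wj := wj, acc := acc, accw := accw, best := best,
        F := F, G := G, H := H } ∧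
      p ≤ s.n ∧ (∀ i < p, p < s.n → s.W (s.A i) < s.W (s.A p)) ∧
      Approx (fun i => s.V (s.A i)) (fun i => s.W (s.A i)) (grid w₀ q) s.K (Finset.range p)
        (q ^ cnt p) F)
    (fun s' => (s.m - cnt s'.p) * ((s.K + 1) * (s.L + 1) * 350) + (s.n - s'.p) * 60) ?_ _ ?_) ?_⟩
  · rintro _ ⟨k, p, d, wj, acc, accw, best, F, G, H, rfl, h₁, h₂, h₃⟩ hp
    simp at hp
    refine wp_seq (wp_fillTable _ (Y := grid w₀ q) hp hV (hw₀.trans_le (hW p hp))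
      (grid_strictMono hw₀ hq).monotone (by simp) hY hs (hbig p hp)) ?_
    rintro t₁ _ ⟨k₁, p₁, wj₁, acc₁, accw₁, G₁, rfl, ht₁, hpp, hpn, hw₁, hw₂, hG⟩
    refine wp_mono (wp_convolve _) ?_
    rintro t₂ _ ⟨k₂, d₂, best₂, F₂, H₂, rfl, ht₂, hF₂⟩
    simp only at ht₁ hpp hpn hw₁ hw₂ hG ht₂ hF₂ ⊢
    have hcnt₁ : cnt p₁ = cnt p + 1 := by
      rw [hcnt]
      simp only
      rw [← Finset.card_insert_of_notMem (a := s.W (s.A p))]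
      · congr 1
        ext z
        simp only [Finset.mem_image, Finset.mem_range, Finset.mem_insert]
        constructor
        · rintro ⟨i, hi, rfl⟩
          by_cases hip : i < p
          · exact .inr ⟨i, hip, rfl⟩
          · exact .inl (hw₁ i (by omega) hi)
        · rintro (rfl | ⟨i, hi, rfl⟩)
          exacts [⟨p, hpp, rfl⟩, ⟨i, by omega, rfl⟩]
      · rw [Finset.mem_image]
        rintro ⟨i, hi, hip⟩
        exact absurd hip (h₂ i (Finset.mem_range.1 hi) hp).ne
    have hcntm : cnt p₁ ≤ s.m := by
      rw [hm, hcnt]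
      exact Finset.card_le_card (Finset.image_subset_image
        (Finset.range_subset_range.2 hpn))
    refine ⟨⟨k₂, p₁, d₂, wj₁, acc₁, accw₁, best₂, F₂, G₁, H₂, rfl, hpn, ?_, ?_⟩, ?_⟩
    · intro i hi hp₁
      by_cases hip : i < p
      · exact (h₂ i hip hp).trans (hw₂ hp₁)
      · rw [hw₁ i (by omega) hi]
        exact hw₂ hp₁
    · have hU : Finset.range p ∪ Finset.Ico p p₁ = Finset.range p₁ := by
        rw [Finset.range_eq_Ico, Finset.Ico_union_Ico_eq_Ico (Nat.zero_le _) hpp.le,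
          Finset.range_eq_Ico]
      have h := Approx.conv hw₀ hq hL (one_le_pow₀ hq.le (n := cnt p))
        (Finset.disjoint_left.2 fun i hi hi' => by
          rw [Finset.mem_range] at hi
          rw [Finset.mem_Ico] at hi'
          omega) (fun i hi => hW i (by
          rw [hU, Finset.mem_range] at hi
          omega)) h₃ hG
      rw [hU, ← pow_succ', ← hcnt₁] at h
      have hF₃ : ∀ k ≤ s.K, F₂ k = Knapsack.conv (shift q s.K) F G₁ k (s.L + 1) := fun k hk => by
        rw [hF₂ k hk]
        exact conv_congr fun d hd => hst d (by omega)
      refine ⟨fun k hk => ?_, fun k hk => ?_, fun k hk k' hk' hkk => ?_⟩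
      · rw [hF₃ k hk]
        exact h.sound k hk
      · rw [hF₃ k hk]
        exact h.complete k hk
      · rw [hF₃ k hk, hF₃ k' hk']
        exact h.mono hk hk' hkk
    · -- one class is paid for by the growth of `cnt`, and its items by the growth of `p`
      obtain ⟨c, hc⟩ := Nat.exists_eq_add_of_le hcntm
      simp only [BExp.cost, IExp.cost]
      rw [show s.m - cnt p = c + 1 by omega, show s.m - cnt p₁ = c by omega]
      have e₁ : (c + 1) * ((s.K + 1) * (s.L + 1) * 350) =
        c * ((s.K + 1) * (s.L + 1) * 350) + (s.K + 1) * (s.L + 1) * 350 := by ring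
      have e₂ : s.K + 1 ≤ (s.K + 1) * (s.L + 1) := Nat.le_mul_of_pos_right _ (by omega)
      have e₃ : (s.K + 1) * ((s.L + 1) * 100 + 60) =
        (s.K + 1) * (s.L + 1) * 100 + (s.K + 1) * 60 := by ring
      omega
  · refine ⟨s.k, 0, s.d, s.wj, s.acc, s.accw, s.best, s.F, s.G, s.H, rfl, Nat.zero_le _,
      fun i hi => by omega, ?_⟩
    refine ⟨fun k _ => ⟨∅, by simp, ?_, by simp [hF]⟩, fun k hk S hS _ => ?_, fun k _ k' _ _ => ?_⟩
    · simpa using grid_nonneg hw₀ hq k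
    · rw [Finset.range_zero, Finset.subset_empty] at hS
      simp [hS, hF]
    · rw [hF, hF]
  · rintro t _ ⟨ht, ⟨k, p, d, wj, acc, accw, best, F, G, H, rfl, h₁, h₂, h₃⟩, hp⟩
    simp at hp ht
    obtain rfl : p = s.n := by omega
    have hmn : cnt s.n = s.m := by rw [hm, hcnt]
    rw [hmn] at h₃
    refine ⟨k, _, d, wj, acc, accw, best, F, G, H, rfl, ?_, h₃⟩
    have : (s.m - cnt 0) * ((s.K + 1) * (s.L + 1) * 350) ≤ s.m * ((s.K + 1) * (s.L + 1) * 350) :=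
      Nat.mul_le_mul_right _ (Nat.sub_le _ _)
    omega

theorem wp_emitTable (s : Mem) (ho : s.out = []) :
    wp emitTable s fun t s' => t ≤ (s.K + 1) * 20 + 10 ∧
      s'.out = (List.range (s.K + 1)).map fun k => (s.Y k, s.F k) := by
  simp only [emitTable, wp, IExp.cost, Mem.setI, IExp.eval]
  have h := wp_for (b := .neg (.ile (.add (.var 9) (.const 1)) (.var 3)))
    (p := .seq (.emit (.get 3 (.var 3)) (.get 4 (.var 3))) <|
      .setIndex 3 (.add (.var 3) (.const 1)))
    (fun x => { s with k := x, out := (List.range x).map fun k => (s.Y k, s.F k) })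
    (lo := 0) (hi := s.K + 1) 9 (Nat.zero_le _) (by simp) (by simp) ?_
  · simp only [List.range_zero, List.map_nil, ← ho] at h
    refine ⟨by norm_num, wp_mono h ?_⟩
    rintro t _ ⟨ht, rfl⟩
    simp only [BExp.cost, IExp.cost] at ht
    exact ⟨by omega, rfl⟩
  · intro x _ _
    simp [List.range_succ]

end RealRAM

namespace RealRAM

open Knapsack

/-- Specification of the algorithm in terms of the memory: `A` is the sorting permutation, `m` the
number of distinct weights, and the output lists the grid together with a table `F` of accuracy
`q ^ m`. The minimality of `K` and `L` serves to estimate the running time. -/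
theorem wp_knapsackProg (s : Mem) (hn : 0 < s.n) (he : 0 < s.eps) (hV : ∀ i, 0 ≤ s.V i)
    (hW : ∀ i < s.n, 0 < s.W i) (hF : ∀ k, s.F k = 0) (ho : s.out = []) :
    wp knapsackProg s fun t s' => ∃ (A : ℕ → ℕ) (m K L : ℕ) (q : ℝ) (F : ℕ → ℝ),
      (seg A 0 s.n).Perm (List.range s.n) ∧
      (∀ x y, x < y → y < s.n → Precedes s.V s.W (A x) (A y)) ∧
      m = ((Finset.range s.n).image fun i => s.W (A i)).card ∧ q = 1 + s.eps / m ∧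
      8 * s.n * s.W (A (s.n - 1)) ≤ grid (s.W (A 0)) q K ∧
      (1 < K → grid (s.W (A 0)) q (K - 1) < 8 * s.n * s.W (A (s.n - 1))) ∧
      (0 < L → q ^ (L - 1) < 2) ∧
      Approx (fun i => s.V (A i)) (fun i => s.W (A i)) (grid (s.W (A 0)) q) K
        (Finset.range s.n) (q ^ m) F ∧
      s'.out = (List.range (K + 1)).map (fun k => (grid (s.W (A 0)) q k, F k)) ∧
      t ≤ 600 * (s.n * (Nat.clog 2 s.n + 2)) + 1000 * (m * ((K + 1) * (L + 1))) := by
  refine wp_seq (wp_sortItems s) ?_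
  rintro t₁ _ ⟨ht₁, i₁, j₁, k₁, lo, mid, hi, wid, A, B, rfl, hA, hs⟩
  have hmem : ∀ x < s.n, A x < s.n := by
    intro x hx
    have : A x ∈ seg A 0 s.n := by
      simp only [seg, List.mem_map, List.mem_range'_1]
      exact ⟨x, by omega, rfl⟩
    simpa using hA.mem_iff.1 this
  have hle : ∀ x y, x ≤ y → y < s.n → s.W (A x) ≤ s.W (A y) := by
    intro x y hxy hy
    rcases eq_or_lt_of_le hxy with rfl | h
    · exact le_rfl
    · exact (hs x y h hy).1
  refine wp_seq (wp_countWeights _ hn fun x y h hy => hle x y h.le hy) ?_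
  rintro t₂ _ ⟨ht₂, rfl⟩
  obtain ⟨m, hm⟩ : ∃ m, m = ((Finset.range s.n).image fun i => s.W (A i)).card := ⟨_, rfl⟩
  have hm₀ : 0 < m := by
    rw [hm, Finset.card_pos, Finset.image_nonempty]
    exact ⟨0, Finset.mem_range.2 hn⟩
  have hw₀ : 0 < s.W (A 0) := hW _ (hmem 0 hn)
  simp only [← hm]
  refine wp_seq (wp_makeGrid _ hm₀ he hw₀) ?_
  rintro t₃ _ ⟨q, K, pw, Y, rfl, ht₃, hq, hK, hpw, hY, hK₁, hK₂⟩
  simp only at ht₁ ht₂ ht₃ hq hpw hY hK₁ hK₂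
  have hq1 : 1 < q := by
    have : 0 < s.eps / m := by positivity
    linarith
  have hw₁ : s.W (A 0) ≤ s.W (A (s.n - 1)) := hle _ _ (Nat.zero_le _) (by omega)
  have hn1 : (1 : ℝ) ≤ s.n := by exact_mod_cast hn
  have hqK : 2 ≤ q ^ K := by
    obtain ⟨k, rfl⟩ : ∃ k, K = k + 1 := ⟨K - 1, by omega⟩
    rw [grid_succ] at hK₁
    have h₁ : s.W (A 0) * 8 ≤ s.W (A 0) * q ^ k := by nlinarith
    have h₂ := le_of_mul_le_mul_left h₁ hw₀
    rw [pow_succ]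
    nlinarith
  refine wp_seq (wp_findHalf _ hpw hqK) ?_
  rintro t₄ _ ⟨L, rfl, ht₄, hLK, hL₁, hL₂⟩
  refine wp_seq (wp_makeShift _ hpw hLK) ?_
  rintro t₅ _ ⟨i₅, d₅, st, rfl, ht₅, hst⟩
  refine wp_seq (wp_processClasses _ hw₀ hq1 hV (fun i hi => hle _ _ (Nat.zero_le _) hi) hs hY hst
    hL₁ hF (fun i hi => ?_) hm) ?_
  · have hi' : i < s.n := hi
    have := hle i (s.n - 1) (by omega) (by omega)
    change s.n * s.W (A i) ≤ grid (s.W (A 0)) q K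
    nlinarith
  rintro t₆ _ ⟨k₆, p, d, wj, acc, accw, best, F, G, H, rfl, ht₆, hFA⟩
  refine wp_mono (wp_emitTable _ ho) ?_
  rintro t₇ s' ⟨ht₇, hout⟩
  refine ⟨A, m, K, L, q, F, hA, hs, hm, hq, hK₁, hK₂, hL₂, hFA, ?_, ?_⟩
  · rw [hout]
    refine List.map_congr_left fun k hk => ?_
    rw [List.mem_range] at hk
    simp only [hY k (Nat.le_of_lt_succ hk)]
  · simp only at ht₄ ht₅ ht₆ ht₇
    have e₁ : (s.n * 150 + 40) * (Nat.clog 2 s.n + 2) ≤ 190 * (s.n * (Nat.clog 2 s.n + 2)) := by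
      nlinarith
    have e₂ : s.n ≤ s.n * (Nat.clog 2 s.n + 2) := Nat.le_mul_of_pos_right _ (by omega)
    have e₃ : (K + 1) * (L + 1) ≤ m * ((K + 1) * (L + 1)) := Nat.le_mul_of_pos_left _ hm₀
    have e₄ : K + 1 ≤ (K + 1) * (L + 1) := Nat.le_mul_of_pos_right _ (by omega)
    have e₅ : L + 1 ≤ (K + 1) * (L + 1) := Nat.le_mul_of_pos_left _ (by omega)
    have e₆ : (L + 1) * (K * 30 + 50) ≤ 50 * ((K + 1) * (L + 1)) := by nlinarith
    have e₇ : m * ((K + 1) * (L + 1) * 350) = 350 * (m * ((K + 1) * (L + 1))) := by ring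
    omega

end RealRAM

namespace Knapsack

open RealRAM

/-! ### Transfer to the knapsack problem -/

/-- The memory that corresponds to the input. -/
noncomputable def inputMem {n : ℕ} (v w : Fin n → ℝ) (ε : ℝ) : Mem where
  n := n
  i := 0
  j := 0
  k := 0
  lo := 0
  mid := 0
  hi := 0
  wid := 0
  m := 0
  K := 0
  L := 0
  p := 0
  d := 0
  A := fun _ => 0
  B := fun _ => 0
  st := fun _ => 0
  eps := ε
  q := 0
  wj := 0
  acc := 0
  accw := 0
  best := 0
  V := fun i => if h : i < n then v ⟨i, h⟩ else 0
  W := fun i => if h : i < n then w ⟨i, h⟩ else 0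
  pw := fun _ => 0
  Y := fun _ => 0
  F := fun _ => 0
  G := fun _ => 0
  H := fun _ => 0
  out := []

theorem store_inputMem {n : ℕ} (v w : Fin n → ℝ) (ε : ℝ) :
    (inputMem v w ε).store = input v w ε := by
  have h₁ : (inputMem v w ε).getI = (input v w ε).ivar := by
    funext x
    rcases x with _|_|_|_|_|_|_|_|_|_|_|_|_|x <;> rfl
  have h₂ : (inputMem v w ε).getIA = (input v w ε).iarr := by
    funext x
    rcases x with _|_|_|x <;> rfl
  have h₃ : (inputMem v w ε).getR = (input v w ε).rvar := by
    funext x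
    rcases x with _|_|_|_|_|_|x <;> rfl
  have h₄ : (inputMem v w ε).getRA = (input v w ε).rarr := by
    funext x i
    rcases x with _|_|_|_|_|_|_|x <;> simp [Mem.getRA, inputMem, input]
  rw [Mem.store, h₁, h₂, h₃, h₄]
  rfl

/-- The infimum that defines `invKnapsack` is attained. -/
theorem invKnapsack_le_iff {n : ℕ} {v w : Fin n → ℝ} {x y : ℝ} :
    invKnapsack v w x ≤ (y : EReal) ↔
      ∃ ξ : Finset (Fin n), x ≤ ∑ i ∈ ξ, v i ∧ ∑ i ∈ ξ, w i ≤ y := by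
  constructor
  · intro h
    obtain ⟨ξ, hξ⟩ := exists_eq_ciInf_of_finite
      (f := fun ξ : Finset (Fin n) => ⨅ _ : x ≤ ∑ i ∈ ξ, v i, ((∑ i ∈ ξ, w i : ℝ) : EReal))
    rw [invKnapsack, ← hξ] at h
    by_cases hx : x ≤ ∑ i ∈ ξ, v i
    · rw [iInf_pos hx] at h
      exact ⟨ξ, hx, EReal.coe_le_coe_iff.1 h⟩
    · rw [iInf_neg hx] at h
      exact absurd (top_le_iff.1 h) (EReal.coe_ne_top y)
  · rintro ⟨ξ, hx, hy⟩
    exact (iInf₂_le ξ hx).trans (EReal.coe_le_coe_iff.2 hy)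

/-- The sorting permutation as a permutation of `Fin n`. -/
theorem exists_positions {n : ℕ} {A : ℕ → ℕ} (hA : (seg A 0 n).Perm (List.range n)) :
    ∃ e : Fin n ≃ Fin n, ∀ i, (e i : ℕ) = A i := by
  have hmem : ∀ i : Fin n, A i < n := by
    intro i
    have : A i ∈ seg A 0 n := by
      simp only [seg, List.mem_map, List.mem_range'_1]
      exact ⟨i, by omega, rfl⟩
    simpa using hA.mem_iff.1 this
  have hpw : ∀ x y, 0 ≤ x → x < y → y < n → A x ≠ A y :=
    pairwise_seg.1 (hA.nodup_iff.2 List.nodup_range)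
  have hinj : Function.Injective fun i : Fin n => (⟨A i, hmem i⟩ : Fin n) := by
    intro i j hij
    rw [Fin.mk.injEq] at hij
    rcases lt_trichotomy i j with h | h | h
    · exact absurd hij (hpw i j (Nat.zero_le _) h j.2)
    · exact h
    · exact absurd hij.symm (hpw j i (Nat.zero_le _) h i.2)
  exact ⟨Equiv.ofBijective _ (Finite.injective_iff_bijective.1 hinj), fun i => rfl⟩

/-- Every set of positions in the sorted order is a selection of items of the input. -/
theorem exists_selection {n : ℕ} {A : ℕ → ℕ} {e : Fin n ≃ Fin n} (he : ∀ i, (e i : ℕ) = A i)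
    {S : Finset ℕ} (hS : S ⊆ Finset.range n) :
    ∃ ξ : Finset (Fin n), ∀ f : ℕ → ℝ, ∑ j ∈ ξ, f j = ∑ i ∈ S, f (A i) := by
  refine ⟨Finset.univ.filter fun j => (e.symm j : ℕ) ∈ S, fun f => ?_⟩
  refine Finset.sum_bij (fun j _ => (e.symm j : ℕ)) ?_ ?_ ?_ ?_
  · intro j hj
    simpa using hj
  · intro j _ j' _ h
    exact e.symm.injective (Fin.ext h)
  · intro i hi
    exact ⟨e ⟨i, Finset.mem_range.1 (hS hi)⟩, by simpa using hi, by simp⟩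
  · intro j _
    rw [← he, e.apply_symm_apply]

/-- Every selection of items of the input is a set of positions in the sorted order. -/
theorem exists_subset_range {n : ℕ} {A : ℕ → ℕ} {e : Fin n ≃ Fin n} (he : ∀ i, (e i : ℕ) = A i)
    (ξ : Finset (Fin n)) :
    ∃ S ⊆ Finset.range n, ∀ f : ℕ → ℝ, ∑ i ∈ S, f (A i) = ∑ j ∈ ξ, f j := by
  refine ⟨ξ.image fun j => (e.symm j : ℕ), ?_, fun f => ?_⟩
  · intro i hi
    obtain ⟨j, _, rfl⟩ := Finset.mem_image.1 hi
    exact Finset.mem_range.2 (e.symm j).2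
  · rw [Finset.sum_image fun j _ j' _ h => e.symm.injective (Fin.ext h)]
    refine Finset.sum_congr rfl fun j _ => ?_
    rw [← he, e.apply_symm_apply]

/-- The accuracy `q ^ m` of the table, with one more factor `q` for rounding the budget of an optimal
selection up to the grid. -/
theorem pow_le_accuracy {ε : ℝ} (he : 0 < ε) (he1 : ε ≤ 1) {m : ℕ} (hm : 0 < m) :
    (1 + ε / m) * (1 + ε / m) ^ m ≤ 1 + 5 * ε := by
  have hm' : (1 : ℝ) ≤ m := by exact_mod_cast hm
  have h₁ : (1 + ε / m) ^ m ≤ Real.exp ε := by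
    have h := pow_le_pow_left₀ (by positivity) (Real.add_one_le_exp (ε / m)) m
    rw [← Real.exp_nat_mul, mul_div_cancel₀ _ (by positivity), add_comm] at h
    exact h
  have h₂ : Real.exp ε ≤ 1 + 2 * ε := by
    have := (abs_le.1 (Real.abs_exp_sub_one_sub_id_le (x := ε) (by rw [abs_of_pos he]; exact he1))).2
    nlinarith
  have h₃ : ε / m ≤ ε := div_le_self he.le hm'
  have h₄ : 0 ≤ ε / m := by positivity
  calc (1 + ε / m) * (1 + ε / m) ^ m ≤ (1 + ε) * (1 + 2 * ε) :=
        mul_le_mul (by linarith) (h₁.trans h₂) (by positivity) (by linarith)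
    _ ≤ 1 + 5 * ε := by nlinarith

/-- A table of accuracy `a` for the sorted items describes a step function that inverts
`invKnapsack` with accuracy `q * a`. -/
theorem stepFun_bounds {n : ℕ} {v w : Fin n → ℝ} {V W : ℕ → ℝ} {A : ℕ → ℕ} {w₀ q a c : ℝ} {K : ℕ}
    {F : ℕ → ℝ} (hV : ∀ i : Fin n, V i = v i) (hW : ∀ i : Fin n, W i = w i)
    (hA : (seg A 0 n).Perm (List.range n)) (hw₀ : 0 < w₀) (hw : ∀ i, w₀ ≤ w i) (hq : 1 < q)
    (ha : 1 ≤ a) (hqa : q * a ≤ c) (hbig : c * ∑ i, w i ≤ grid w₀ q K)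
    (hF : Approx (fun i => V (A i)) (fun i => W (A i)) (grid w₀ q) K (Finset.range n) a F) (y : ℝ) :
    stepInverse (invKnapsack v w) (y / c) ≤
        stepFun ((List.range (K + 1)).map fun k => (grid w₀ q k, F k)) y ∧
      stepFun ((List.range (K + 1)).map fun k => (grid w₀ q k, F k)) y ≤
        stepInverse (invKnapsack v w) y := by
  obtain ⟨e, he⟩ := exists_positions hA
  have hc : 0 < c := by nlinarith
  constructor
  · refine iSup₂_le fun x hx => ?_
    obtain ⟨ξ, hxξ, hξ⟩ := invKnapsack_le_iff.1 hx
    rw [le_div_iff₀ hc] at hξ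
    obtain ⟨S, hS, hSξ⟩ := exists_subset_range he ξ
    have hSV : ∑ i ∈ S, V (A i) = ∑ i ∈ ξ, v i := by simp_rw [hSξ, hV]
    have hSW : ∑ i ∈ S, W (A i) = ∑ i ∈ ξ, w i := by simp_rw [hSξ, hW]
    have hwt : ∑ i ∈ ξ, w i = 0 ∨ w₀ ≤ ∑ i ∈ ξ, w i := by
      rcases ξ.eq_empty_or_nonempty with rfl | ⟨i, hi⟩
      · simp
      · exact .inr ((hw i).trans (Finset.single_le_sum (fun j _ => hw₀.le.trans (hw j)) hi))
    have hwt₀ : 0 ≤ ∑ i ∈ ξ, w i := Finset.sum_nonneg fun j _ => hw₀.le.trans (hw j)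
    have hle : ∑ i ∈ ξ, w i ≤ ∑ i, w i := Finset.sum_le_sum_of_subset_of_nonneg
      (Finset.subset_univ _) fun j _ _ => hw₀.le.trans (hw j)
    have hac : a ≤ c := by nlinarith
    obtain ⟨k, hk, hk₁, hk₂⟩ := exists_grid (K := K) (x := a * ∑ i ∈ ξ, w i) hw₀ hq
      (hwt.imp (fun h => by simp [h]) fun h => by nlinarith)
      ((mul_le_mul hac hle hwt₀ hc.le).trans hbig)
    have hFk := hF.complete k hk S hS (by simpa only [hSW] using hk₁)
    have hky : grid w₀ q k ≤ y := by
      rw [← mul_assoc] at hk₂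
      nlinarith
    refine le_iSup₂_of_le (grid w₀ q k, F k) ⟨?_, hky⟩ ?_
    · exact List.mem_map.2 ⟨k, List.mem_range.2 (by omega), rfl⟩
    · exact EReal.coe_le_coe_iff.2 (hxξ.trans (by simpa only [hSV] using hFk))
  · refine iSup₂_le fun p hp => ?_
    obtain ⟨hp, hpy⟩ := hp
    obtain ⟨k, hk, rfl⟩ := List.mem_map.1 hp
    rw [List.mem_range] at hk
    obtain ⟨S, hS, hS₁, hS₂⟩ := hF.sound k (by omega)
    obtain ⟨ξ, hξ⟩ := exists_selection he hS
    refine le_iSup₂_of_le (F k) (invKnapsack_le_iff.2 ⟨ξ, ?_, ?_⟩) le_rfl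
    · simpa only [← hξ, hV] using hS₂
    · simpa only [← hξ, hW] using hS₁.trans hpy

/-! ### The running time -/

theorem clog_le {n : ℕ} {Λ : ℝ} (hn : 0 < n) (hΛ : Real.log (max n 2 : ℕ) ≤ Λ) :
    (Nat.clog 2 n : ℝ) + 2 ≤ 8 * Λ := by
  have hl2 := Real.log_two_gt_d9
  have h2 : Real.log 2 ≤ Λ := (Real.log_le_log two_pos (by simp)).trans hΛ
  rcases Nat.lt_or_ge n 2 with h | h
  · obtain rfl : n = 1 := by omega
    simp
    linarith
  · have h₁ := Nat.pow_pred_clog_lt_self one_lt_two (show 1 < n by omega)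
    have h₂ : ((Nat.clog 2 n).pred : ℝ) * Real.log 2 ≤ Real.log n := by
      rw [← Real.log_pow]
      exact Real.log_le_log (by positivity) (by exact_mod_cast h₁.le)
    rw [max_eq_left h] at hΛ
    have h₃ : (Nat.clog 2 n : ℝ) ≤ (Nat.clog 2 n).pred + 1 := by
      exact_mod_cast (by rw [Nat.pred_eq_sub_one]; omega)
    have : (0 : ℝ) ≤ (Nat.clog 2 n).pred := Nat.cast_nonneg _
    nlinarith

theorem half_le_log {δ : ℝ} (h₀ : 0 < δ) (h₁ : δ ≤ 1) : δ / 2 ≤ Real.log (1 + δ) := by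
  refine le_trans ?_ (Real.one_sub_inv_le_log_of_pos (by linarith))
  rw [inv_eq_one_div, le_sub_iff_add_le, ← le_sub_iff_add_le', div_le_iff₀ (by linarith)]
  nlinarith

/-- A bound for the exponents `k` for which `(1 + δ) ^ k` stays below `x`. -/
theorem mul_le_of_pow_le {δ x Λ : ℝ} {k : ℕ} (h₀ : 0 < δ) (h₁ : δ ≤ 1) (hx : (1 + δ) ^ k ≤ x)
    (hΛ : Real.log x ≤ Λ) : k * δ ≤ 2 * Λ := by
  have h := Real.log_le_log (by positivity) hx
  rw [Real.log_pow] at h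
  have := mul_le_mul_of_nonneg_left (half_le_log h₀ h₁) (Nat.cast_nonneg (α := ℝ) k)
  linarith

/-- The cost of all convolutions: with `δ = ε / m`, the grid has `O(Λ / δ)` points, and `O(1 / δ)`
budgets are tried at each of them. -/
theorem mul_mul_le {n m K L : ℕ} {ε Λ w₀ w₁ : ℝ} (hn : 0 < n) (hm : 0 < m) (he : 0 < ε)
    (he1 : ε ≤ 1) (hw₀ : 0 < w₀) (hw : w₀ ≤ w₁) (hΛ : Λ = Real.log ((max n 2 : ℕ) * w₁ / w₀))
    (hK : 1 < K → grid w₀ (1 + ε / m) (K - 1) < 8 * n * w₁)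
    (hL : 0 < L → (1 + ε / m) ^ (L - 1) < 2) :
    (m : ℝ) * ((K + 1) * (L + 1)) ≤ 56 * (m ^ 3 / ε ^ 2 * Λ) := by
  have hm' : (1 : ℝ) ≤ m := by exact_mod_cast hm
  obtain ⟨δ, hδ⟩ : ∃ δ, δ = ε / m := ⟨_, rfl⟩
  rw [← hδ] at hK hL
  have hw₁ : 0 < w₁ := hw₀.trans_le hw
  have hδ₀ : 0 < δ := by rw [hδ]; positivity
  have hδ₁ : δ ≤ 1 := by
    rw [hδ]
    exact (div_le_self he.le hm').trans he1
  have hN : (2 : ℝ) ≤ (max n 2 : ℕ) := by exact_mod_cast le_max_right n 2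
  have hnN : (n : ℝ) ≤ (max n 2 : ℕ) := by exact_mod_cast le_max_left n 2
  have hr : 1 ≤ w₁ / w₀ := (one_le_div hw₀).2 hw
  have hl2 := Real.log_two_gt_d9
  have hl2' := Real.log_two_lt_d9
  have h2 : Real.log 2 ≤ Λ := by
    rw [hΛ, mul_div_assoc]
    exact Real.log_le_log two_pos (by nlinarith)
  have hK' : (K + 1) * δ ≤ 14 * Λ := by
    rcases Nat.lt_or_ge 1 K with h | h
    · obtain ⟨k, rfl⟩ : ∃ k, K = k + 2 := ⟨K - 2, by omega⟩
      have hk := hK h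
      rw [show k + 2 - 1 = k + 1 by omega, grid_succ] at hk
      have := mul_le_of_pow_le (k := k) (x := 2 ^ 3 * ((max n 2 : ℕ) * w₁ / w₀)) (Λ := 4 * Λ)
        hδ₀ hδ₁ ?_ ?_
      · push_cast
        nlinarith
      · -- `2 ^ 3` is the factor `8` by which the grid exceeds the total weight
        rw [← mul_div_assoc, le_div_iff₀ hw₀]
        nlinarith
      · rw [Real.log_mul (by norm_num) (by positivity), Real.log_pow, ← hΛ]
        push_cast
        linarith
    · have : (K : ℝ) ≤ 1 := by exact_mod_cast h
      nlinarith
  have hL' : (L + 1) * δ ≤ 4 := by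
    rcases Nat.eq_zero_or_pos L with rfl | h
    · simp; linarith
    · obtain ⟨l, rfl⟩ : ∃ l, L = l + 1 := ⟨L - 1, by omega⟩
      have := mul_le_of_pow_le (k := l) hδ₀ hδ₁ (hL h).le hl2'.le
      push_cast
      nlinarith
  have hmul : ((K + 1) * δ) * ((L + 1) * δ) ≤ 14 * Λ * 4 :=
    mul_le_mul hK' hL' (by positivity) (by linarith)
  have hε : ε = δ * m := by rw [hδ]; field_simp
  have hrw : (m : ℝ) ^ 3 / ε ^ 2 * Λ = m * Λ / δ ^ 2 := by
    rw [hε]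
    field_simp
  rw [hrw, ← mul_div_assoc, le_div_iff₀ (by positivity)]
  nlinarith

end Knapsack

open RealRAM Knapsack

theorem theorem4 :
    ∃ (P : RealRAM.Prog) (C c : ℝ), 0 < C ∧ 0 < c ∧
      ∀ (n m : ℕ) (v w : Fin n → ℝ) (ε : ℝ), 0 < n →
        (∀ i, 0 ≤ v i) → (∀ i, 0 < w i) → (Finset.univ.image w).card = m → 0 < ε → ε ≤ 1 →
        ∃ (t : ℕ) (σ : RealRAM.Store),
          RealRAM.Exec P (Knapsack.input v w ε) t σ ∧
          (t : ℝ) ≤ C * (((n : ℝ) + (m : ℝ) ^ 3 / ε ^ 2) *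
            Real.log ((max n 2 : ℕ) * (⨆ i, w i) / (⨅ i, w i))) ∧
          Knapsack.IsStepList σ.out ∧
          ∀ y : ℝ,
            Knapsack.stepInverse (Knapsack.invKnapsack v w) (y / (1 + c * ε))
                ≤ Knapsack.stepFun σ.out y ∧
            Knapsack.stepFun σ.out y
                ≤ Knapsack.stepInverse (Knapsack.invKnapsack v w) y := by
  refine ⟨knapsackProg, 56000, 5, by norm_num, by norm_num, ?_⟩
  intro n m v w ε hn hv hw hm he he1
  have hV : ∀ i : Fin n, (inputMem v w ε).V i = v i := fun i => by simp [inputMem]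
  have hW : ∀ i : Fin n, (inputMem v w ε).W i = w i := fun i => by simp [inputMem]
  obtain ⟨t, s', hrun, A, m', K, L, q, F, hA, hs, hm', hq, hK₁, hK₂, hL, hF, hout, ht⟩ :=
    wp_sound (wp_knapsackProg (inputMem v w ε) hn he
      (fun i => by
        by_cases h : i < n
        · exact (hv ⟨i, h⟩).trans_eq (hV ⟨i, h⟩).symm
        · simp [inputMem, h])
      (fun i h => (hw ⟨i, h⟩).trans_eq (hW ⟨i, h⟩).symm) (fun _ => rfl) rfl)
  -- the concrete memory is forgotten, so that `V` and `W` are atoms in what follows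
  obtain ⟨V, hVdef⟩ : ∃ V, V = (inputMem v w ε).V := ⟨_, rfl⟩
  obtain ⟨W, hWdef⟩ : ∃ W, W = (inputMem v w ε).W := ⟨_, rfl⟩
  simp only [← hVdef, ← hWdef] at hV hW hs hm' hK₁ hK₂ hF hout
  simp only [show (inputMem v w ε).n = n from rfl, show (inputMem v w ε).eps = ε from rfl]
    at hA hs hm' hq hK₁ hK₂ hF ht
  rw [store_inputMem] at hrun
  obtain ⟨e, hE⟩ := exists_positions hA
  have hWA : ∀ i : Fin n, W (A i) = w (e i) := fun i => by rw [← hE, hW]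
  obtain rfl : m' = m := by
    rw [hm', ← hm]
    congr 1
    ext z
    simp only [Finset.mem_image, Finset.mem_range, Finset.mem_univ, true_and]
    constructor
    · rintro ⟨i, hi, rfl⟩
      exact ⟨e ⟨i, hi⟩, (hWA ⟨i, hi⟩).symm⟩
    · rintro ⟨j, rfl⟩
      exact ⟨e.symm j, (e.symm j).2, by rw [hWA, e.apply_symm_apply]⟩
  have : Nonempty (Fin n) := ⟨⟨0, hn⟩⟩
  have hm₀ : 0 < m' := by
    rw [← hm, Finset.card_pos, Finset.image_nonempty]
    exact Finset.univ_nonempty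
  have hle : ∀ x y, x ≤ y → y < n → W (A x) ≤ W (A y) := by
    intro x y hxy hy
    rcases eq_or_lt_of_le hxy with rfl | h
    · exact le_rfl
    · exact (hs x y h hy).1
  have hmin : ∀ j, W (A 0) ≤ w j := fun j => by
    rw [← e.apply_symm_apply j, ← hWA]
    exact hle _ _ (Nat.zero_le _) (e.symm j).2
  have hmax : ∀ j, w j ≤ W (A (n - 1)) := fun j => by
    rw [← e.apply_symm_apply j, ← hWA]
    exact hle _ _ (by omega) (by omega)
  have hInf : ⨅ i, w i = W (A 0) := by
    refine le_antisymm ?_ (le_ciInf hmin)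
    exact (ciInf_le (Set.finite_range w).bddBelow (e ⟨0, hn⟩)).trans_eq (hWA ⟨0, hn⟩).symm
  have hSup : ⨆ i, w i = W (A (n - 1)) := by
    refine le_antisymm (ciSup_le hmax) ?_
    exact (hWA ⟨n - 1, by omega⟩).trans_le
      (le_ciSup (Set.finite_range w).bddAbove (e ⟨n - 1, by omega⟩))
  have hw₀ : 0 < W (A 0) := (hw (e ⟨0, hn⟩)).trans_eq (hWA ⟨0, hn⟩).symm
  have hw₁ : W (A 0) ≤ W (A (n - 1)) := hle _ _ (Nat.zero_le _) (by omega)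
  have hq1 : 1 < q := by
    have : 0 < ε / m' := by positivity
    linarith
  refine ⟨t, _, hrun, ?_, ?_, ?_⟩
  · rw [hInf, hSup]
    obtain ⟨Λ, hΛ⟩ : ∃ Λ, Λ = Real.log ((max n 2 : ℕ) * W (A (n - 1)) / W (A 0)) := ⟨_, rfl⟩
    rw [← hΛ]
    have h₁ : (Nat.clog 2 n : ℝ) + 2 ≤ 8 * Λ := by
      refine clog_le hn ?_
      rw [hΛ, mul_div_assoc]
      refine Real.log_le_log (by positivity) (le_mul_of_one_le_right (by positivity) ?_)
      exact (one_le_div hw₀).2 hw₁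
    rw [hq] at hK₂ hL
    have h₂ := mul_mul_le hn hm₀ he he1 hw₀ hw₁ hΛ hK₂ hL
    have h₃ : (t : ℝ) ≤ 600 * (n * (Nat.clog 2 n + 2)) + 1000 * (m' * ((K + 1) * (L + 1))) := by
      exact_mod_cast ht
    have h₄ : (n : ℝ) * (Nat.clog 2 n + 2) ≤ n * (8 * Λ) :=
      mul_le_mul_of_nonneg_left h₁ (Nat.cast_nonneg n)
    have h₅ : 0 ≤ (n : ℝ) * Λ := by
      have : 0 ≤ Λ := by linarith [Nat.cast_nonneg (α := ℝ) (Nat.clog 2 n)]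
      positivity
    rw [add_mul]
    linarith
  · change IsStepList s'.out
    rw [hout, IsStepList, List.pairwise_map]
    refine List.Pairwise.imp_of_mem ?_ List.pairwise_lt_range
    intro a b ha hb hab
    rw [List.mem_range] at ha hb
    exact ⟨grid_strictMono hw₀ hq1 hab, hF.mono (Set.mem_Iic.2 (by omega))
      (Set.mem_Iic.2 (by omega)) hab.le⟩
  · change ∀ y, _ ≤ stepFun s'.out y ∧ stepFun s'.out y ≤ _
    rw [hout]
    refine stepFun_bounds hV hW hA hw₀ hmin hq1 (one_le_pow₀ hq1.le)
      (by rw [hq]; exact pow_le_accuracy he he1 hm₀) ?_ hF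
    -- the grid exceeds `8` times the total weight, and `1 + 5 * ε ≤ 6`
    have hsum : ∑ i, w i ≤ n * W (A (n - 1)) := by
      have := Finset.sum_le_card_nsmul Finset.univ w _ fun j _ => hmax j
      simpa using this
    have hsum₀ : 0 ≤ ∑ i, w i := Finset.sum_nonneg fun j _ => (hw j).le
    nlinarith
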